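/- Equip $\mathbb{R}^d$ with the Euclidean norm and the Borel $\sigma$-algebra, let $\mathcal{P}_2(\mathbb{R}^d)$ be the set of Borel probability measures with finite second moment, and let $W_2(\mu,\nu)=\inf_{\gamma}\|x-y\|_{L^2(\gamma)}\in[0,\infty]$, the infimum being over all couplings $\gamma$ of $\mu$ and $\nu$ (it is finite on $\mathcal{P}_2(\mathbb{R}^d)$). A curve $t\mapsto\mu_t\in\mathcal P_2(\mathbb R^d)$, $t\in[0,1]$, is absolutely continuous if there is $m\in L^1([0,1])$ with $W_2(\mu_s,\mu_t)\le\int_s^t m(r)\,\mathrm dr$ for all $0\le s\le t\le1$. A curve $\mu_t$ of probability measures is narrowly continuous if $t\mapsto\int f\,\mathrm d\mu_t$ is continuous for every bounded continuous $f$. The pair $(\mu_t,v_t)$ satisfies the continuity equation $\partial_t\mu_t+\nabla_x\cdot(\mu_tv_t)=0$ if $$\int_0^1\int_{\mathbb{R}^d}\big(\partial_t\varphi(t,x)+\langle\nabla_x\varphi(t,x),v_t(x)\rangle\big)\,\mathrm d\mu_t(x)\,\mathrm dt=0\qquad\text{for all }\varphi\in C_c^\infty((0,1)\times\mathbb{R}^d),$$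 the integral being absolutely convergent. **Theorem.** Let $(\mathcal K_t)_{t\in[0,1]}$ be Markov kernels on $\mathbb R^d$, let $\mu_1\in\mathcal P_2(\mathbb R^d)$, let $\alpha_t:=\mathcal K_t(y,\cdot)\times_y\mu_1$, i.e. $\int f\,\mathrm d\alpha_t=\int\!\int f(x,y)\,\mathcal K_t(y,\mathrm dx)\,\mathrm d\mu_1(y)$ for bounded measurable $f$, and let $\nu_t:=\pi^1_\sharp\alpha_t$ be its first marginal. Let $(t,x,y)\mapsto v_t^y(x)\in\mathbb R^d$ be measurable on $[0,1]\times\mathbb R^d\times\mathbb R^d$. Assume that for $\mu_1$-a.e. $y$ the curve $t\mapsto\mathcal K_t(y,\cdot)$ is absolutely continuous in $(\mathcal P_2(\mathbb R^d),W_2)$ and $(\mathcal K_t(y,\cdot),v_t^y)$ satisfies the continuity equation, and that $$\int_0^1\Big(\int_{\mathbb R^d\times\mathbb R^d}\|v_t^y(x)\|^2\,\mathrm d\alpha_t(x,y)\Big)^{1/2}\mathrm dt<\infty .$$ Then: 1. $t\mapsto\alpha_t$ and $t\mapsto\nu_t$ are narrowly continuous. 2. There is $m\in L^1([0,1])$ with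 $W_2(\nu_s,\nu_t)\le\int_s^tm(r)\,\mathrm dr$ for all $0\le s\le t\le1$. If moreover $\nu_{t_0}\in\mathcal P_2(\mathbb R^d)$ for some $t_0\in[0,1]$, then $\nu_t\in\mathcal P_2(\mathbb R^d)$ for all $t$, and $\nu_t$ is an absolutely continuous curve in $(\mathcal P_2(\mathbb R^d),W_2)$. 3. Let $\alpha_t=\alpha_t^x\times_x\nu_t$ be any disintegrations with respect to the first projection ($t\in[0,1]$), and put $$v_t(x):=\int_{\mathbb R^d}v_t^y(x)\,\mathrm d\alpha_t^x(y).$$ For a.e. $t$ and $\nu_t$-a.e. $x$ the integrand $y\mapsto v_t^y(x)$ is $\alpha_t^x$-integrable; there is a measurable $w:[0,1]\times\mathbb R^d\to\mathbb R^d$ with $w(t,\cdot)=v_t$ $\nu_t$-a.e. for every $t$; and $(\nu_t,v_t)$ satisfies the continuity equation. -/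

import Mathlib

open MeasureTheory ProbabilityTheory
open scoped ENNReal ContDiff unitInterval

/-- `ℝ^d` with the Euclidean norm. -/
abbrev Euc (d : ℕ) : Type := EuclideanSpace ℝ (Fin d)

/-- `μ` belongs to `P₂(ℝ^d)`: a Borel probability measure with finite second moment. -/
def MemP2 {d : ℕ} (μ : Measure (Euc d)) : Prop :=
  IsProbabilityMeasure μ ∧ ∫⁻ x, ‖x‖ₑ ^ 2 ∂μ < ⊤

/-- The plans (couplings) with first marginal `μ` and second marginal `ν`. -/
def couplings {d : ℕ} (μ ν : Measure (Euc d)) : Set (Measure (Euc d × Euc d)) :=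
  {γ | γ.map Prod.fst = μ ∧ γ.map Prod.snd = ν}

/-- The Wasserstein-2 distance
`W₂(μ, ν) = inf_γ ‖x - y‖_{L²(γ)}`, as an extended nonnegative number (it is finite on `P₂`). -/
noncomputable def W2 {d : ℕ} (μ ν : Measure (Euc d)) : ℝ≥0∞ :=
  ⨅ γ ∈ couplings μ ν, eLpNorm (fun p : Euc d × Euc d => p.1 - p.2) 2 γ

/-- The curve `μ : [0,1] → P` satisfies `W₂(μ_s, μ_t) ≤ ∫_s^t m(r) dr` for all `s ≤ t`,
for some `m ∈ L¹([0,1])`. -/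
def HasL1Speed {d : ℕ} (μ : I → Measure (Euc d)) : Prop :=
  ∃ m : ℝ → ℝ, IntegrableOn m (Set.Icc 0 1) ∧
    ∀ s t : I, s ≤ t → W2 (μ s) (μ t) ≤ ENNReal.ofReal (∫ r in (s : ℝ)..(t : ℝ), m r)

/-- `μ` is an absolutely continuous curve `[0,1] → (P₂(ℝ^d), W₂)`. -/
def IsACCurve {d : ℕ} (μ : I → Measure (Euc d)) : Prop :=
  (∀ t, MemP2 (μ t)) ∧ HasL1Speed μ

/-- Narrow continuity: `t ↦ ∫ f dμ_t` is continuous on `[0,1]` for all `f ∈ C_b(X)`. -/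
def NarrowlyContinuous {X : Type*} [TopologicalSpace X] [MeasurableSpace X]
    (μ : I → Measure X) : Prop :=
  ∀ f : BoundedContinuousFunction X ℝ, Continuous fun t => ∫ x, f x ∂(μ t)

/-- The test functions `C_c^∞((0,1) × ℝ^d)`, as functions on `ℝ × ℝ^d`. -/
def IsTestFunction {d : ℕ} (φ : ℝ × Euc d → ℝ) : Prop :=
  ContDiff ℝ ∞ φ ∧ HasCompactSupport φ ∧ tsupport φ ⊆ Set.Ioo (0 : ℝ) 1 ×ˢ Set.univ

/-- `∂_t φ + ⟨∇_x φ, v_t⟩` at the point `(t, x)`. -/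
noncomputable def transportIntegrand {d : ℕ} (φ : ℝ × Euc d → ℝ) (v : I → Euc d → Euc d)
    (t : I) (x : Euc d) : ℝ :=
  deriv (fun s : ℝ => φ (s, x)) t + inner ℝ (gradient (fun z => φ ((t : ℝ), z)) x) (v t x)

/-- `(μ_t, v_t)` satisfies `∂_t μ_t + ∇_x · (μ_t v_t) = 0` on `(0,1) × ℝ^d` in the sense of
distributions; the absolute convergence of the integral is part of the claim. -/
def SolvesCE {d : ℕ} (μ : I → Measure (Euc d)) (v : I → Euc d → Euc d) : Prop :=
  ∀ φ : ℝ × Euc d → ℝ, IsTestFunction φ →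
    ∫⁻ t : I, ∫⁻ x, ‖transportIntegrand φ v t x‖ₑ ∂(μ t) < ⊤ ∧
    ∫ t : I, ∫ x, transportIntegrand φ v t x ∂(μ t) = 0

/-- `K(y, ·) ×_y μ`, the measure on pairs `(x, y)` with
`∫ f dα = ∫ ∫ f(x, y) K(y, dx) dμ(y)`. -/
noncomputable def plan {d : ℕ} (K : Kernel (Euc d) (Euc d)) (μ : Measure (Euc d)) :
    Measure (Euc d × Euc d) :=
  (μ ⊗ₘ K).map Prod.swap

/-- The first marginal of `K(y, ·) ×_y μ`. -/
noncomputable def firstMarginal {d : ℕ} (K : Kernel (Euc d) (Euc d)) (μ : Measure (Euc d)) :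
    Measure (Euc d) :=
  (plan K μ).map Prod.fst

/-- `D(x, ·) = α^x` is a disintegration of `α` with respect to the first projection:
a Markov kernel with `α = α^x ×_x (π¹)_♯ α`. -/
def IsDisintegration {d : ℕ} (α : Measure (Euc d × Euc d)) (D : Kernel (Euc d) (Euc d)) : Prop :=
  IsMarkovKernel D ∧ (α.map Prod.fst) ⊗ₘ D = α

/-- The averaged velocity `v_t(x) = ∫ v_t^y(x) dα_t^x(y)`, where `v t y x` is `v_t^y(x)` and
`D t x` is `α_t^x`. -/
noncomputable def averagedVelocity {d : ℕ} (v : I → Euc d → Euc d → Euc d)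
    (D : I → Kernel (Euc d) (Euc d)) (t : I) (x : Euc d) : Euc d :=
  ∫ y, v t y x ∂(D t x)

/-! Everything is done on the plans `α_t`, and only the results are projected to the first marginal.
Absolute continuity of the fibres gives narrow continuity of `K t y` in `t` for a.e. `y`, and
dominated convergence carries it to `α_t` and `ν_t`. It also yields a version of the kernels that is
jointly measurable in `(t, y)` (`exists_joint_kernel`). Then Fubini applies, and integrating the
fibrewise continuity equations over `y` gives one on the plans (`plan_continuityEquation`), tested
with functions of `(t, x)`. Since the integrand is affine in the velocity, disintegrating `α_t` over
`x` replaces `v_t^y(x)` by its average; this is the continuity equation for `ν_t`.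

For the Wasserstein bound, test with `χ(t) η(x)`. The du Bois-Reymond lemma turns the equation into
`∫ η dν_b - ∫ η dν_a = ∫_a^b ∫ Dη(v) dα_r dr`, and Cauchy–Schwarz in `L²(α_r)` bounds this by `∫_a^b
m ‖Dη‖_{L²(ν_r)} dr`, where `m` is the `L²(α_r)` norm of the velocity
(`hasWeakSpeed_firstMarginal`).

Such a weak speed bound controls `W2` by duality (`HasWeakSpeed.W2_le`). Let the Hopf–Lax semigroup
`u_θ` of `f` run with the clock `θ' = m + 1`. Formally `∂_θ u = -‖Du‖² / 2`, so with `Q = ∫ ‖Du‖²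
dν_r` the derivative of `∫ u dν_r` is at most `m √Q - θ' Q / 2 ≤ θ' / 2`. Hence `∫ u_T dν_t - ∫ f
dν_s ≤ T / 2`, where `T` is the time elapsed on the clock, and Kantorovich duality converts this
into `W2 ≤ T`. The formal computation is made rigorous by mollifying `u` and by a step inequality
with quadratic error, which disappears under bisection. Adding 1 to `m` keeps `T` positive and
preserves integrability. -/

set_option linter.unusedSectionVars false

/-! ### Kantorovich duality from Hahn–Banach and Riesz -/

section Duality

variable {E : Type*} [NormedAddCommGroup E]

/-- Lipschitz functions that are constant outside a compact set. -/
def lipConstAtInfty (E : Type*) [NormedAddCommGroup E] : Submodule ℝ (E → ℝ) where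
  carrier := {f | (∃ L, LipschitzWith L f) ∧ ∃ c, HasCompactSupport fun x => f x - c}
  zero_mem' := ⟨⟨0, LipschitzWith.const _⟩, 0, by simp [HasCompactSupport, tsupport]⟩
  add_mem' := by
    rintro f g ⟨⟨K, hK⟩, a, ha⟩ ⟨⟨L, hL⟩, b, hb⟩
    refine ⟨⟨_, hK.add hL⟩, a + b, ?_⟩
    have h := HasCompactSupport.add ha hb
    rwa [show (fun x => f x - a) + (fun x => g x - b) = fun x => (f + g) x - (a + b) from
      funext fun x => by simp only [Pi.add_apply]; ring] at h
  smul_mem' := by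
    rintro r f ⟨⟨K, hK⟩, a, ha⟩
    refine ⟨⟨_, (lipschitzWith_smul r).comp hK⟩, r * a, ?_⟩
    have h : HasCompactSupport ((fun _ => r) * fun x => f x - a) := ha.mul_left
    rwa [show ((fun _ => r) * fun x => f x - a) = fun x => (r • f) x - r * a from
      funext fun x => by simp only [Pi.mul_apply, Pi.smul_apply, smul_eq_mul]; ring] at h

lemma const_mem_lipConstAtInfty (c : ℝ) : (fun _ => c) ∈ lipConstAtInfty E :=
  ⟨⟨0, LipschitzWith.const _⟩, c, by simp [HasCompactSupport, tsupport]⟩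

lemma continuous_of_mem_lipConstAtInfty {f : E → ℝ} (hf : f ∈ lipConstAtInfty E) :
    Continuous f := hf.1.choose_spec.continuous

variable [ProperSpace E]

lemma integrable_of_mem_lipConstAtInfty [MeasurableSpace E] [BorelSpace E] {f : E → ℝ}
    (hf : f ∈ lipConstAtInfty E) (μ : Measure E) [IsFiniteMeasure μ] : Integrable f μ := by
  obtain ⟨c, hc⟩ := hf.2
  have h := ((continuous_of_mem_lipConstAtInfty hf).sub
    (continuous_const (y := c))).integrable_of_hasCompactSupport (μ := μ) hc
  simpa using h.add (integrable_const c)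

/-- The costs of the dual superhedges of `h`. -/
def dualCosts [MeasurableSpace E] (μ ν : Measure E) (c : E × E → ℝ) (C : ℝ) (h : E × E → ℝ) :
    Set ℝ :=
  {r | ∃ f ∈ lipConstAtInfty E, ∃ g ∈ lipConstAtInfty E, ∃ a : ℝ, 0 ≤ a ∧
    (∀ p, h p ≤ f p.1 + g p.2 + a * c p) ∧ r = ∫ x, f x ∂μ + ∫ y, g y ∂ν + a * C}

variable [MeasurableSpace E] [BorelSpace E] {μ ν : Measure E} [IsProbabilityMeasure μ]
  [IsProbabilityMeasure ν] {c : E × E → ℝ} {C : ℝ}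

/-- If `0 ≤ f + g + a c`, then `-f / b` and `-g / b` are admissible in `H` for every `b > a`,
because `c ≥ 0`. Multiplying the resulting bound by `b` and letting `b` decrease to `a` also covers
`a = 0`, where division by `a` would fail. -/
lemma dualCosts_zero_nonneg (hc : ∀ p, 0 ≤ c p)
    (H : ∀ f ∈ lipConstAtInfty E, ∀ g ∈ lipConstAtInfty E, (∀ x y, f x + g y ≤ c (x, y)) →
      ∫ x, f x ∂μ + ∫ y, g y ∂ν ≤ C) {r : ℝ} (hr : r ∈ dualCosts μ ν c C 0) : 0 ≤ r := by
  obtain ⟨f, hf, g, hg, a, ha, h, rfl⟩ := hr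
  have key : ∀ b : ℝ, a < b → 0 ≤ ∫ x, f x ∂μ + ∫ y, g y ∂ν + b * C := by
    intro b hb
    have hb0 : 0 < b := ha.trans_lt hb
    have h1 := H ((-b⁻¹) • f) (Submodule.smul_mem _ _ hf) ((-b⁻¹) • g) (Submodule.smul_mem _ _ hg)
      (fun x y => by
        have h2 := h (x, y)
        have h3 : a * c (x, y) ≤ b * c (x, y) := mul_le_mul_of_nonneg_right hb.le (hc _)
        simp only [Pi.zero_apply, Pi.smul_apply, smul_eq_mul] at h2 ⊢
        have h4 : 0 ≤ b⁻¹ * (f x + g y + b * c (x, y)) :=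
          mul_nonneg (inv_pos.2 hb0).le (by linarith)
        have h5 : b⁻¹ * (f x + g y + b * c (x, y)) = b⁻¹ * (f x + g y) + c (x, y) := by
          field_simp
        linarith)
    simp only [Pi.smul_apply, smul_eq_mul, integral_const_mul] at h1
    have h2 := mul_le_mul_of_nonneg_left h1 hb0.le
    have h3 : b * (-b⁻¹ * ∫ x, f x ∂μ + -b⁻¹ * ∫ y, g y ∂ν) = -(∫ x, f x ∂μ + ∫ y, g y ∂ν) := by
      field_simp
      ring
    linarith
  have hlim : Filter.Tendsto (fun b : ℝ => ∫ x, f x ∂μ + ∫ y, g y ∂ν + b * C)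
      (nhdsWithin a (Set.Ioi a)) (nhds (∫ x, f x ∂μ + ∫ y, g y ∂ν + a * C)) := by
    apply Continuous.continuousWithinAt
    fun_prop
  exact ge_of_tendsto hlim (Filter.eventually_of_mem self_mem_nhdsWithin key)

lemma dualCosts_add {h k : E × E → ℝ} {r s : ℝ} (hr : r ∈ dualCosts μ ν c C h)
    (hs : s ∈ dualCosts μ ν c C k) : r + s ∈ dualCosts μ ν c C (h + k) := by
  obtain ⟨f, hf, g, hg, a, ha, h1, rfl⟩ := hr
  obtain ⟨f', hf', g', hg', a', ha', h1', rfl⟩ := hs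
  refine ⟨f + f', Submodule.add_mem _ hf hf', g + g', Submodule.add_mem _ hg hg', a + a',
    add_nonneg ha ha', fun p => ?_, ?_⟩
  · have := h1 p; have := h1' p
    simp only [Pi.add_apply]; linarith
  · simp only [Pi.add_apply]
    rw [integral_add (integrable_of_mem_lipConstAtInfty hf μ)
      (integrable_of_mem_lipConstAtInfty hf' μ), integral_add
      (integrable_of_mem_lipConstAtInfty hg ν) (integrable_of_mem_lipConstAtInfty hg' ν)]
    ring

lemma dualCosts_smul {h : E × E → ℝ} {r b : ℝ} (hb : 0 ≤ b) (hr : r ∈ dualCosts μ ν c C h) :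
    b * r ∈ dualCosts μ ν c C (b • h) := by
  obtain ⟨f, hf, g, hg, a, ha, h1, rfl⟩ := hr
  refine ⟨b • f, Submodule.smul_mem _ _ hf, b • g, Submodule.smul_mem _ _ hg, b * a,
    mul_nonneg hb ha, fun p => ?_, ?_⟩
  · have := mul_le_mul_of_nonneg_left (h1 p) hb
    simp only [Pi.smul_apply, smul_eq_mul]; linarith
  · simp only [Pi.smul_apply, smul_eq_mul, integral_const_mul]
    ring

lemma const_mem_dualCosts {h : E × E → ℝ} {A : ℝ} (hA : ∀ p, h p ≤ A) :
    A ∈ dualCosts μ ν c C h :=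
  ⟨fun _ => A, const_mem_lipConstAtInfty A, fun _ => 0, const_mem_lipConstAtInfty 0, 0, le_rfl,
    fun p => by simpa using hA p, by simp⟩

/-- A cost of `h` plus the constant cost `A` of `-h` is a cost of `0`, hence nonnegative. This makes
the infimum of the costs a finite sublinear functional. -/
lemma bddBelow_dualCosts (hc : ∀ p, 0 ≤ c p)
    (H : ∀ f ∈ lipConstAtInfty E, ∀ g ∈ lipConstAtInfty E, (∀ x y, f x + g y ≤ c (x, y)) →
      ∫ x, f x ∂μ + ∫ y, g y ∂ν ≤ C) {h : E × E → ℝ} {A : ℝ} (hA : ∀ p, -h p ≤ A) :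
    BddBelow (dualCosts μ ν c C h) := by
  refine ⟨-A, fun r hr => ?_⟩
  have h1 := dualCosts_add hr (const_mem_dualCosts (h := -h) hA)
  rw [add_neg_cancel] at h1
  linarith [dualCosts_zero_nonneg hc H h1]

open CompactlySupported in
/-- Hahn–Banach: a linear functional on `C_c(E × E)` dominated by all dual superhedges. -/
lemma exists_linear_le_dualCosts (hc : ∀ p, 0 ≤ c p)
    (H : ∀ f ∈ lipConstAtInfty E, ∀ g ∈ lipConstAtInfty E, (∀ x y, f x + g y ≤ c (x, y)) →
      ∫ x, f x ∂μ + ∫ y, g y ∂ν ≤ C) :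
    ∃ Λ : C_c(E × E, ℝ) →ₗ[ℝ] ℝ, ∀ (h : C_c(E × E, ℝ)) (r : ℝ),
      r ∈ dualCosts μ ν c C h → Λ h ≤ r := by
  have hbd : ∀ h : C_c(E × E, ℝ), ∃ A : ℝ, ∀ p, ‖h p‖ ≤ A := fun h =>
    h.continuous.bounded_above_of_compact_support h.hasCompactSupport
  have hne : ∀ h : C_c(E × E, ℝ), (dualCosts μ ν c C h).Nonempty := fun h => by
    obtain ⟨A, hA⟩ := hbd h
    exact ⟨A, const_mem_dualCosts fun p => (le_abs_self _).trans (hA p)⟩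
  have hbb : ∀ h : C_c(E × E, ℝ), BddBelow (dualCosts μ ν c C h) := fun h => by
    obtain ⟨A, hA⟩ := hbd h
    exact bddBelow_dualCosts hc H fun p => (neg_le_abs _).trans (hA p)
  have hsmul : ∀ b : ℝ, 0 < b → ∀ h : C_c(E × E, ℝ),
      sInf (dualCosts μ ν c C (b • h : C_c(E × E, ℝ))) ≤ b * sInf (dualCosts μ ν c C h) := by
    intro b hb h
    rw [← div_le_iff₀' hb]
    refine le_csInf (hne h) fun r hr => ?_
    rw [div_le_iff₀' hb]
    exact csInf_le (hbb _) (dualCosts_smul hb.le hr)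
  -- The functional to be extended is zero on the zero subspace; its domination there says that all
  -- costs of `0` are nonnegative.
  suffices h : ∃ Λ : C_c(E × E, ℝ) →ₗ[ℝ] ℝ,
      (∀ x : (⟨⊥, 0⟩ : C_c(E × E, ℝ) →ₗ.[ℝ] ℝ).domain,
        Λ x = (⟨⊥, 0⟩ : C_c(E × E, ℝ) →ₗ.[ℝ] ℝ) x) ∧
      ∀ h, Λ h ≤ sInf (dualCosts μ ν c C h) by
    obtain ⟨Λ, -, hΛ⟩ := h
    exact ⟨Λ, fun h r hr => (hΛ h).trans (csInf_le (hbb h) hr)⟩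
  refine exists_extension_of_le_sublinear _ _ ?_ ?_ ?_
  · intro b hb h
    refine le_antisymm (hsmul b hb h) ?_
    have := hsmul b⁻¹ (inv_pos.2 hb) (b • h)
    rw [smul_smul, inv_mul_cancel₀ hb.ne', one_smul] at this
    rwa [← div_eq_inv_mul, le_div_iff₀' hb] at this
  · intro h k
    have h1 : ∀ s ∈ dualCosts μ ν c C k,
        sInf (dualCosts μ ν c C (h + k : C_c(E × E, ℝ))) - s ≤ sInf (dualCosts μ ν c C h) :=
      fun s hs => le_csInf (hne h) fun r hr => by
        linarith [csInf_le (hbb (h + k)) (dualCosts_add hr hs)]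
    have h2 : sInf (dualCosts μ ν c C (h + k : C_c(E × E, ℝ))) - sInf (dualCosts μ ν c C h)
        ≤ sInf (dualCosts μ ν c C k) :=
      le_csInf (hne k) fun s hs => by linarith [h1 s hs]
    linarith
  · rintro ⟨x, hx⟩
    obtain rfl : x = 0 := by simpa using hx
    exact le_csInf (hne 0) fun r hr => dualCosts_zero_nonneg hc H hr


/-- The thickened indicator of a compact set, as a real function. -/
noncomputable def cutoff (K : Set E) {δ : ℝ} (hδ : 0 < δ) (x : E) : ℝ := thickenedIndicator hδ K x

lemma lipschitzWith_cutoff (K : Set E) {δ : ℝ} (hδ : 0 < δ) :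
    LipschitzWith δ.toNNReal⁻¹ (cutoff K hδ) := by
  exact fun x y => lipschitzWith_thickenedIndicator hδ K x y

lemma continuous_cutoff (K : Set E) {δ : ℝ} (hδ : 0 < δ) : Continuous (cutoff K hδ) :=
  (lipschitzWith_cutoff K hδ).continuous

lemma cutoff_nonneg (K : Set E) {δ : ℝ} (hδ : 0 < δ) (x : E) : 0 ≤ cutoff K hδ x :=
  NNReal.coe_nonneg _

lemma cutoff_le_one (K : Set E) {δ : ℝ} (hδ : 0 < δ) (x : E) : cutoff K hδ x ≤ 1 := by
  exact_mod_cast thickenedIndicator_le_one hδ K x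

lemma cutoff_eq_one {K : Set E} {δ : ℝ} (hδ : 0 < δ) {x : E} (hx : x ∈ K) :
    cutoff K hδ x = 1 := by
  simp [cutoff, thickenedIndicator_one hδ K hx]

lemma hasCompactSupport_cutoff {K : Set E} (hK : IsCompact K) {δ : ℝ} (hδ : 0 < δ) :
    HasCompactSupport (cutoff K hδ) := by
  refine HasCompactSupport.of_support_subset_isCompact (hK.cthickening (r := δ)) fun x hx => ?_
  by_contra h
  exact hx (by simp [cutoff, thickenedIndicator_zero hδ K
    fun h' => h (Metric.thickening_subset_cthickening δ K h')])

lemma cutoff_mem_lipConstAtInfty {K : Set E} (hK : IsCompact K) {δ : ℝ} (hδ : 0 < δ) :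
    cutoff K hδ ∈ lipConstAtInfty E :=
  ⟨⟨_, lipschitzWith_cutoff K hδ⟩, 0, by simpa using hasCompactSupport_cutoff hK hδ⟩

open CompactlySupported in
/-- The product `f(x) g(y)` as a compactly supported function. -/
def ccProd (f g : E → ℝ) (hf : Continuous f) (hg : Continuous g) (hf' : HasCompactSupport f)
    (hg' : HasCompactSupport g) : C_c(E × E, ℝ) where
  toFun p := f p.1 * g p.2
  continuous_toFun := by fun_prop
  hasCompactSupport' := by
    refine HasCompactSupport.of_support_subset_isCompact (hf'.isCompact.prod hg'.isCompact)
      fun p hp => ?_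
    rw [Function.mem_support] at hp
    exact ⟨subset_closure (left_ne_zero_of_mul hp), subset_closure (right_ne_zero_of_mul hp)⟩

open CompactlySupported in
/-- The product of the cutoffs of two compact sets. -/
noncomputable def cutoffProd {K K' : Set E} (hK : IsCompact K) (hK' : IsCompact K') {δ : ℝ}
    (hδ : 0 < δ) : C_c(E × E, ℝ) :=
  ccProd (cutoff K hδ) (cutoff K' hδ) (continuous_cutoff K hδ) (continuous_cutoff K' hδ)
    (hasCompactSupport_cutoff hK hδ) (hasCompactSupport_cutoff hK' hδ)

lemma cutoffProd_apply {K K' : Set E} (hK : IsCompact K) (hK' : IsCompact K') {δ : ℝ}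
    (hδ : 0 < δ) (p : E × E) :
    cutoffProd hK hK' hδ p = cutoff K hδ p.1 * cutoff K' hδ p.2 := rfl

lemma iUnion_closedBall_nat_prod :
    ⋃ n : ℕ, Metric.closedBall (0 : E) n ×ˢ Metric.closedBall (0 : E) n = Set.univ := by
  refine Set.eq_univ_of_forall fun p => ?_
  obtain ⟨n, hn⟩ := exists_nat_ge (max ‖p.1‖ ‖p.2‖)
  exact Set.mem_iUnion.2 ⟨n, by simpa using (le_max_left _ _).trans hn,
    by simpa using (le_max_right _ _).trans hn⟩

/-- Exhausting the product by balls first shows that `γ` is finite. The marginal is then inner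
regular, so comparing it with `μ` on compact sets is enough. -/
lemma map_fst_le_of_forall_isCompact {γ : Measure (E × E)}
    (h : ∀ K K' : Set E, IsCompact K → IsCompact K' → γ (K ×ˢ K') ≤ μ K) :
    γ.map Prod.fst ≤ μ := by
  have huniv : γ Set.univ ≤ 1 := by
    rw [← iUnion_closedBall_nat_prod, Monotone.measure_iUnion]
    · exact iSup_le fun n => (h _ _ (isCompact_closedBall _ _) (isCompact_closedBall _ _)).trans
        prob_le_one
    · intro m n hmn
      have : Metric.closedBall (0 : E) m ⊆ Metric.closedBall 0 n :=
        Metric.closedBall_subset_closedBall (by exact_mod_cast hmn)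
      exact Set.prod_mono this this
  have : IsFiniteMeasure γ := ⟨huniv.trans_lt ENNReal.one_lt_top⟩
  have hK : ∀ K : Set E, IsCompact K → γ.map Prod.fst K ≤ μ K := by
    intro K hK
    rw [Measure.map_apply measurable_fst hK.measurableSet,
      show (Prod.fst ⁻¹' K : Set (E × E)) = ⋃ n : ℕ, K ×ˢ Metric.closedBall (0 : E) n by
        ext p
        simp only [Set.mem_preimage, Set.mem_iUnion, Set.mem_prod, Metric.mem_closedBall,
          dist_zero_right, exists_and_left, iff_self_and]
        exact fun _ => exists_nat_ge _, Monotone.measure_iUnion]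
    · exact iSup_le fun n => h _ _ hK (isCompact_closedBall _ _)
    · intro m n hmn
      exact Set.prod_mono le_rfl (Metric.closedBall_subset_closedBall (by exact_mod_cast hmn))
  refine Measure.le_iff.2 fun s hs => ?_
  rw [hs.measure_eq_iSup_isCompact]
  exact iSup₂_le fun K hKs => iSup_le fun hKc => (hK K hKc).trans (measure_mono hKs)

/-- As `δ → 0` the cutoffs converge to the indicator of the closed set `K`, and so do their
integrals. -/
lemma le_of_forall_le_integral_cutoff {K : Set E} (hK : IsCompact K) {r : ℝ≥0∞}
    (h : ∀ δ : ℝ, ∀ hδ : 0 < δ, r ≤ ENNReal.ofReal (∫ x, cutoff K hδ x ∂μ)) : r ≤ μ K := by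
  have hlim := tendsto_integral_thickenedIndicator_of_isClosed μ hK.isClosed
    (δs := fun n : ℕ => 1 / ((n : ℝ) + 1)) (fun n => by positivity)
    tendsto_one_div_add_atTop_nhds_zero_nat
  have h2 := (ENNReal.continuous_ofReal.tendsto _).comp hlim
  rw [ofReal_measureReal] at h2
  exact ge_of_tendsto' h2 fun n => h _ _

/-- **Kantorovich duality**, with Lipschitz test functions that are constant near infinity. -/
theorem exists_coupling_lintegral_le (hcc : Continuous c) (hc : ∀ p, 0 ≤ c p)
    (H : ∀ f ∈ lipConstAtInfty E, ∀ g ∈ lipConstAtInfty E, (∀ x y, f x + g y ≤ c (x, y)) →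
      ∫ x, f x ∂μ + ∫ y, g y ∂ν ≤ C) :
    ∃ γ : Measure (E × E), γ.map Prod.fst = μ ∧ γ.map Prod.snd = ν ∧
      ∫⁻ p, ENNReal.ofReal (c p) ∂γ ≤ ENNReal.ofReal C := by
  obtain ⟨L, hL⟩ := exists_linear_le_dualCosts (μ := μ) (ν := ν) hc H
  -- The zero superhedge dominates `-h`, so `L (-h) ≤ 0`.
  have hpos : ∀ h, 0 ≤ h → 0 ≤ L h := fun h hh => by
    have := hL (-h) 0 (const_mem_dualCosts fun p => by simpa using hh p)
    rw [map_neg] at this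
    linarith
  set Λ := PositiveLinearMap.mk₀ L hpos
  have hΛL : ∀ h, Λ h = L h := fun h => rfl
  set γ := RealRMK.rieszMeasure Λ
  have h1 : ∀ K K' : Set E, IsCompact K → IsCompact K' → γ (K ×ˢ K') ≤ μ K := by
    intro K K' hK hK'
    refine le_of_forall_le_integral_cutoff hK fun δ hδ => ?_
    refine (RealRMK.rieszMeasure_le_of_eq_one Λ (f := cutoffProd hK hK' hδ)
      (fun p => mul_nonneg (cutoff_nonneg _ _ _) (cutoff_nonneg _ _ _)) (hK.prod hK')
      fun p hp => by simp [cutoffProd_apply, cutoff_eq_one hδ hp.1, cutoff_eq_one hδ hp.2]).trans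
      (ENNReal.ofReal_le_ofReal (hL _ _ ⟨_, cutoff_mem_lipConstAtInfty hK hδ, fun _ => 0,
        const_mem_lipConstAtInfty 0, 0, le_rfl, fun p => ?_, by simp⟩))
    simpa [cutoffProd_apply] using
      mul_le_of_le_one_right (cutoff_nonneg K hδ p.1) (cutoff_le_one K' hδ p.2)
  have h2 : ∀ K K' : Set E, IsCompact K → IsCompact K' → γ (K' ×ˢ K) ≤ ν K := by
    intro K K' hK hK'
    refine le_of_forall_le_integral_cutoff hK fun δ hδ => ?_
    refine (RealRMK.rieszMeasure_le_of_eq_one Λ (f := cutoffProd hK' hK hδ)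
      (fun p => mul_nonneg (cutoff_nonneg _ _ _) (cutoff_nonneg _ _ _)) (hK'.prod hK)
      fun p hp => by simp [cutoffProd_apply, cutoff_eq_one hδ hp.1, cutoff_eq_one hδ hp.2]).trans
      (ENNReal.ofReal_le_ofReal (hL _ _ ⟨fun _ => 0, const_mem_lipConstAtInfty 0, _,
        cutoff_mem_lipConstAtInfty hK hδ, 0, le_rfl, fun p => ?_, by simp⟩))
    simpa [cutoffProd_apply] using
      mul_le_of_le_one_left (cutoff_nonneg K hδ p.2) (cutoff_le_one K' hδ p.1)
  have hfst := map_fst_le_of_forall_isCompact h1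
  have hsnd : γ.map Prod.snd ≤ ν := by
    have := map_fst_le_of_forall_isCompact (μ := ν) (γ := γ.map Prod.swap) fun K K' hK hK' => by
      rw [Measure.map_apply measurable_swap (hK.measurableSet.prod hK'.measurableSet),
        Set.preimage_swap_prod]
      exact h2 K K' hK hK'
    rwa [Measure.map_map measurable_fst measurable_swap] at this
  let B (n : ℕ) : Set E := Metric.closedBall 0 n
  have hB : ∀ n, IsCompact (B n) := fun n => isCompact_closedBall _ _
  -- The marginals of `γ` lie below `μ` and `ν`; equality only requires that no mass is lost at
  -- infinity.
  have hmass : 1 ≤ γ Set.univ := by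
    have hn : ∀ n, ENNReal.ofReal (μ.real (B n) + ν.real (B n) - 1) ≤ γ Set.univ := by
      intro n
      refine le_trans (ENNReal.ofReal_le_ofReal ?_) (RealRMK.le_rieszMeasure_tsupport_subset Λ
        (f := cutoffProd (hB n) (hB n) one_pos) (fun p => ⟨mul_nonneg (cutoff_nonneg _ _ _)
          (cutoff_nonneg _ _ _), mul_le_one₀ (cutoff_le_one _ _ _) (cutoff_nonneg _ _ _)
          (cutoff_le_one _ _ _)⟩) (Set.subset_univ _))
      have hint : ∀ (ρ : Measure E) [IsProbabilityMeasure ρ],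
          ρ.real (B n) ≤ ∫ x, cutoff (B n) one_pos x ∂ρ := by
        intro ρ _
        rw [← integral_indicator_one (hB n).measurableSet]
        refine integral_mono ((integrable_const 1).indicator (hB n).measurableSet)
          (integrable_of_mem_lipConstAtInfty (cutoff_mem_lipConstAtInfty (hB n) one_pos) ρ)
          fun x => ?_
        by_cases hx : x ∈ B n
        · simp [hx, cutoff_eq_one one_pos hx]
        · simpa [hx] using cutoff_nonneg _ _ _
      -- With `χ` the cutoff, `(1 - χ(x)) (1 - χ(y)) ≥ 0` says that `-χ(x) χ(y) ≤ (1 - χ(x)) -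
      -- χ(y)`, a superhedge with `a = 0`.
      have h3 := hL (-cutoffProd (hB n) (hB n) one_pos) _ ⟨(fun _ => 1) - cutoff (B n) one_pos,
        Submodule.sub_mem _ (const_mem_lipConstAtInfty 1)
          (cutoff_mem_lipConstAtInfty (hB n) one_pos), -cutoff (B n) one_pos,
        Submodule.neg_mem _ (cutoff_mem_lipConstAtInfty (hB n) one_pos), 0, le_rfl, fun p => ?_,
        rfl⟩
      · simp only [map_neg, Pi.sub_apply, Pi.neg_apply, integral_neg] at h3
        rw [integral_sub (integrable_const _) (integrable_of_mem_lipConstAtInfty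
          (cutoff_mem_lipConstAtInfty (hB n) one_pos) μ)] at h3
        simp only [integral_const, probReal_univ, smul_eq_mul] at h3
        rw [hΛL]
        linarith [hint μ, hint ν]
      · have h4 := mul_nonneg (sub_nonneg.2 (cutoff_le_one (B n) one_pos p.1))
          (sub_nonneg.2 (cutoff_le_one (B n) one_pos p.2))
        simp only [CompactlySupportedContinuousMap.coe_neg, Pi.neg_apply, cutoffProd_apply,
          Pi.sub_apply]
        linarith
    have hBlim : ∀ (ρ : Measure E) [IsProbabilityMeasure ρ],
        Filter.Tendsto (fun n => ρ.real (B n)) Filter.atTop (nhds 1) := by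
      intro ρ _
      have hmono : Monotone B := fun m n hmn =>
        Metric.closedBall_subset_closedBall (by exact_mod_cast hmn)
      have := tendsto_measure_iUnion_atTop (μ := ρ) hmono
      rw [show ⋃ n, B n = Set.univ from Metric.iUnion_closedBall_nat 0, measure_univ] at this
      exact (ENNReal.tendsto_toReal ENNReal.one_ne_top).comp this
    have hlim := (ENNReal.continuous_ofReal.tendsto _).comp
      (((hBlim μ).add (hBlim ν)).sub_const 1)
    norm_num at hlim
    exact le_of_tendsto' hlim hn
  have hμ : γ.map Prod.fst = μ := by
    have : IsFiniteMeasure (γ.map Prod.fst) := isFiniteMeasure_of_le μ hfst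
    refine Measure.eq_of_le_of_measure_univ_eq hfst (le_antisymm (hfst _) ?_)
    rwa [measure_univ, Measure.map_apply measurable_fst MeasurableSet.univ]
  have hν : γ.map Prod.snd = ν := by
    have : IsFiniteMeasure (γ.map Prod.snd) := isFiniteMeasure_of_le ν hsnd
    refine Measure.eq_of_le_of_measure_univ_eq hsnd (le_antisymm (hsnd _) ?_)
    rwa [measure_univ, Measure.map_apply measurable_snd MeasurableSet.univ]
  refine ⟨γ, hμ, hν, ?_⟩
  let χ (n : ℕ) := cutoffProd (hB n) (hB n) one_pos
  let F (n : ℕ) : CompactlySupportedContinuousMap (E × E) ℝ :=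
    ⟨⟨fun p => c p * χ n p, hcc.mul (χ n).continuous⟩, (χ n).hasCompactSupport.mul_left⟩
  have hF0 : ∀ n p, 0 ≤ F n p := fun n p => mul_nonneg (hc p)
    (mul_nonneg (cutoff_nonneg _ _ _) (cutoff_nonneg _ _ _))
  have hFC : ∀ n, ∫⁻ p, ENNReal.ofReal (F n p) ∂γ ≤ ENNReal.ofReal C := by
    intro n
    have hi : Integrable (fun p => F n p) γ :=
      (F n).continuous.integrable_of_hasCompactSupport (F n).hasCompactSupport
    rw [← ofReal_integral_eq_lintegral_ofReal hi (Filter.Eventually.of_forall (hF0 n)),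
      RealRMK.integral_rieszMeasure]
    -- The truncated cost is dominated by `0 + 0 + 1 * c`, whose dual cost is `C`. Fatou's lemma
    -- then removes the truncation.
    refine ENNReal.ofReal_le_ofReal (hL _ _ ⟨fun _ => 0, const_mem_lipConstAtInfty 0, fun _ => 0,
      const_mem_lipConstAtInfty 0, 1, zero_le_one, fun p => ?_, by simp⟩)
    simp only [zero_add, one_mul]
    exact mul_le_of_le_one_right (hc p) (mul_le_one₀ (cutoff_le_one (B n) one_pos p.1)
      (cutoff_nonneg (B n) one_pos p.2) (cutoff_le_one (B n) one_pos p.2))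
  have hliminf : ∀ p, Filter.liminf (fun n => ENNReal.ofReal (F n p)) Filter.atTop
      = ENNReal.ofReal (c p) := by
    intro p
    refine (tendsto_const_nhds.congr' ?_).liminf_eq
    obtain ⟨N, hN⟩ := exists_nat_ge (max ‖p.1‖ ‖p.2‖)
    filter_upwards [Filter.eventually_ge_atTop N] with n hn
    have hNn : (N : ℝ) ≤ n := by exact_mod_cast hn
    have hp1 : p.1 ∈ B n := by simpa [B] using (le_max_left _ _).trans (hN.trans hNn)
    have hp2 : p.2 ∈ B n := by simpa [B] using (le_max_right _ _).trans (hN.trans hNn)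
    simp [F, χ, cutoffProd_apply, cutoff_eq_one one_pos hp1, cutoff_eq_one one_pos hp2]
  calc ∫⁻ p, ENNReal.ofReal (c p) ∂γ
      = ∫⁻ p, Filter.liminf (fun n => ENNReal.ofReal (F n p)) Filter.atTop ∂γ := by
        simp_rw [hliminf]
    _ ≤ Filter.liminf (fun n => ∫⁻ p, ENNReal.ofReal (F n p) ∂γ) Filter.atTop :=
        lintegral_liminf_le fun n => (F n).continuous.measurable.ennreal_ofReal
    _ ≤ ENNReal.ofReal C :=
        Filter.liminf_le_of_le (by isBoundedDefault) fun b hb =>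
          (hb.exists.choose_spec).trans (hFC _)

end Duality

/-! ### The Hopf–Lax semigroup -/

section HopfLax

variable {E : Type*} [NormedAddCommGroup E] [InnerProductSpace ℝ E]

/-- The Hopf–Lax semigroup `inf_p f(x - θ p) + θ ‖p‖² / 2`. -/
noncomputable def hopfLax (f : E → ℝ) (θ : ℝ) (x : E) : ℝ :=
  ⨅ p : E, (f (x - θ • p) + θ * ‖p‖ ^ 2 / 2)

variable {f : E → ℝ} {θ h M : ℝ}

lemma bddBelow_hopfLax (hf : ∀ x, -M ≤ f x) (hθ : 0 ≤ θ) (x : E) :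
    BddBelow (Set.range fun p : E => f (x - θ • p) + θ * ‖p‖ ^ 2 / 2) := by
  refine ⟨-M, ?_⟩
  rintro _ ⟨p, rfl⟩
  have : 0 ≤ θ * ‖p‖ ^ 2 / 2 := by positivity
  linarith [hf (x - θ • p)]

lemma hopfLax_le (hf : ∀ x, -M ≤ f x) (hθ : 0 ≤ θ) (x p : E) :
    hopfLax f θ x ≤ f (x - θ • p) + θ * ‖p‖ ^ 2 / 2 :=
  ciInf_le (bddBelow_hopfLax hf hθ x) p

@[simp] lemma hopfLax_zero (f : E → ℝ) : hopfLax f 0 = f := by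
  ext x; simp [hopfLax]

/-- Travelling with velocity `q` for time `θ` and `p` for time `h` reaches the same point as the
averaged velocity `(θ q + h p) / (θ + h)` for time `θ + h`, and convexity of the squared norm makes
the latter cheaper. This is the Hamilton–Jacobi inequality in a form that needs no derivative. -/
lemma hopfLax_add_le (hf : ∀ x, -M ≤ f x) (hθ : 0 ≤ θ) (hh : 0 ≤ h) (x p : E) :
    hopfLax f (θ + h) (x + h • p) ≤ hopfLax f θ x + h * ‖p‖ ^ 2 / 2 := by
  rw [← sub_le_iff_le_add]
  refine le_ciInf fun q => ?_
  rcases (add_nonneg hθ hh).eq_or_lt with h0 | h0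
  · obtain rfl : θ = 0 := by linarith
    obtain rfl : h = 0 := by linarith
    simp
  have h1 := hopfLax_le hf (add_nonneg hθ hh) (x + h • p)
    ((θ + h)⁻¹ • (θ • q + h • p))
  rw [smul_inv_smul₀ h0.ne', add_sub_add_right_eq_sub] at h1
  have h2 : (θ + h) * ‖(θ + h)⁻¹ • (θ • q + h • p)‖ ^ 2 ≤ θ * ‖q‖ ^ 2 + h * ‖p‖ ^ 2 := by
    rw [norm_smul, mul_pow, norm_inv, Real.norm_of_nonneg h0.le]
    have h3 : ‖θ • q + h • p‖ ≤ θ * ‖q‖ + h * ‖p‖ := by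
      refine (norm_add_le _ _).trans ?_
      rw [norm_smul, norm_smul, Real.norm_of_nonneg hθ, Real.norm_of_nonneg hh]
    have h4 : ‖θ • q + h • p‖ ^ 2 ≤ (θ * ‖q‖ + h * ‖p‖) ^ 2 := by gcongr
    have h5 : (θ * ‖q‖ + h * ‖p‖) ^ 2 ≤ (θ + h) * (θ * ‖q‖ ^ 2 + h * ‖p‖ ^ 2) := by
      -- The difference of the two sides is exactly `θ h (‖q‖ - ‖p‖)²`.
      nlinarith [mul_nonneg (mul_nonneg hθ hh) (sq_nonneg (‖q‖ - ‖p‖))]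
    calc (θ + h) * ((θ + h)⁻¹ ^ 2 * ‖θ • q + h • p‖ ^ 2)
        = (θ + h)⁻¹ * ‖θ • q + h • p‖ ^ 2 := by field_simp
      _ ≤ (θ + h)⁻¹ * ((θ + h) * (θ * ‖q‖ ^ 2 + h * ‖p‖ ^ 2)) := by
        gcongr
        exact h4.trans h5
      _ = _ := by field_simp
  linarith

lemma lipschitzWith_hopfLax (hf : ∀ x, -M ≤ f x) (hθ : 0 ≤ θ) {L : NNReal}
    (hL : LipschitzWith L f) : LipschitzWith L (hopfLax f θ) := by
  refine LipschitzWith.of_le_add_mul L fun x y => ?_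
  rw [← sub_le_iff_le_add]
  refine le_ciInf fun p => ?_
  have h1 := hopfLax_le hf hθ x p
  have h2 := hL.le_add_mul (x - θ • p) (y - θ • p)
  rw [dist_sub_right] at h2
  linarith

lemma exists_abs_sub_le_of_mem_lipConstAtInfty (hf : f ∈ lipConstAtInfty E) :
    ∃ c R M : ℝ, 0 ≤ M ∧ (∀ x, |f x - c| ≤ M) ∧ ∀ x, R < ‖x‖ → f x = c := by
  obtain ⟨c, hc⟩ := hf.2
  obtain ⟨M, hM⟩ := ((continuous_of_mem_lipConstAtInfty hf).sub
    (continuous_const (y := c))).bounded_above_of_compact_support hc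
  obtain ⟨R, hR⟩ := hc.isCompact.isBounded.exists_norm_le
  refine ⟨c, R, M, (norm_nonneg _).trans (hM 0), hM, fun x hx => ?_⟩
  by_contra h
  exact absurd (hR x (subset_tsupport _ (by simpa [sub_eq_zero] using h))) (not_le.2 hx)

lemma exists_neg_le_of_mem_lipConstAtInfty (hf : f ∈ lipConstAtInfty E) :
    ∃ M : ℝ, ∀ x, -M ≤ f x := by
  obtain ⟨c, R, M, -, hM, -⟩ := exists_abs_sub_le_of_mem_lipConstAtInfty hf
  exact ⟨M - c, fun x => by linarith [(abs_le.1 (hM x)).1]⟩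

/-- From a point with `‖x‖ > R + 2 M + θ`, reaching the ball where `f` differs from `c` requires `θ
‖p‖ > 2 M + θ`. Then `‖p‖ ≥ 1` and the kinetic cost is at least `M`, so the gain in `f`, at most
`M`, never pays: the infimum is `c`. -/
lemma hopfLax_mem_lipConstAtInfty [ProperSpace E] (hf : f ∈ lipConstAtInfty E) (hθ : 0 ≤ θ) :
    hopfLax f θ ∈ lipConstAtInfty E := by
  obtain ⟨B, hB⟩ := exists_neg_le_of_mem_lipConstAtInfty hf
  obtain ⟨L, hL⟩ := hf.1
  obtain ⟨c, R, M, hM0, hM, hR⟩ := exists_abs_sub_le_of_mem_lipConstAtInfty hf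
  refine ⟨⟨L, lipschitzWith_hopfLax hB hθ hL⟩, c, HasCompactSupport.of_support_subset_isCompact
    (isCompact_closedBall (0 : E) (R + 2 * M + θ)) fun x hx => ?_⟩
  by_contra hx'
  have hxn : R + 2 * M + θ < ‖x‖ := by simpa using hx'
  refine hx (sub_eq_zero.2 (le_antisymm ?_ (le_ciInf fun p => ?_)))
  · have := hopfLax_le hB hθ x 0
    rwa [smul_zero, sub_zero, hR x (by linarith), norm_zero, zero_pow two_ne_zero, mul_zero,
      zero_div, add_zero] at this
  · have hpos : 0 ≤ θ * ‖p‖ ^ 2 / 2 := by positivity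
    by_cases hp : R < ‖x - θ • p‖
    · rw [hR _ hp]; linarith
    · have h1 : ‖x‖ ≤ ‖x - θ • p‖ + θ * ‖p‖ := by
        have := norm_add_le (x - θ • p) (θ • p)
        rwa [sub_add_cancel, norm_smul, Real.norm_of_nonneg hθ] at this
      have h2 : 2 * M + θ < θ * ‖p‖ := by linarith
      have hθ' : 0 < θ := by
        rcases hθ.eq_or_lt with h0 | h0
        · rw [← h0] at h2; linarith
        · exact h0
      have h3 : 1 ≤ ‖p‖ := by
        by_contra h4
        nlinarith
      have h4 : 2 * M ≤ θ * ‖p‖ ^ 2 := by nlinarith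
      linarith [(abs_le.1 (hM (x - θ • p))).1]

end HopfLax

/-! ### Mollification -/

section Mollify

variable {d : ℕ} (φ : ContDiffBump (0 : Euc d))

/-- Convolution with a normalized smooth bump. -/
noncomputable def mollify (g : Euc d → ℝ) (x : Euc d) : ℝ :=
  ∫ t, φ.normed volume t * g (x - t)

lemma mollify_eq_convolution (g : Euc d → ℝ) : mollify φ g =
    convolution (φ.normed volume) g (ContinuousLinearMap.lsmul ℝ ℝ) volume := rfl

variable {φ} {g k : Euc d → ℝ}

lemma integrable_normed_mul (hg : Continuous g) (x : Euc d) :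
    Integrable fun t => φ.normed volume t * g (x - t) :=
  (φ.continuous_normed.mul (by fun_prop)).integrable_of_hasCompactSupport
    (φ.hasCompactSupport_normed.mul_right)

lemma contDiff_mollify (hg : Continuous g) : ContDiff ℝ ∞ (mollify φ g) :=
  (φ.hasCompactSupport_normed (μ := volume)).contDiff_convolution_left (n := ⊤)
    (ContinuousLinearMap.lsmul ℝ ℝ) φ.contDiff_normed (hg.locallyIntegrable (μ := volume))

lemma mollify_sub_const (hg : Continuous g) (c : ℝ) :
    (fun x => mollify φ g x - c) = mollify φ fun x => g x - c := by
  ext x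
  simp only [mollify, mul_sub]
  rw [integral_sub (integrable_normed_mul hg x) (φ.integrable_normed.mul_const c),
    integral_mul_const, φ.integral_normed, one_mul]

lemma hasCompactSupport_mollify_sub_const (hg : Continuous g) {c : ℝ}
    (hc : HasCompactSupport fun x => g x - c) :
    HasCompactSupport fun x => mollify φ g x - c := by
  rw [mollify_sub_const hg, mollify_eq_convolution]
  exact φ.hasCompactSupport_normed.convolution _ hc

/-- Averaging against a probability density commutes with translations and preserves order. Both the
Lipschitz bound and the Hamilton–Jacobi inequality survive mollification for this reason. -/
lemma mollify_add_le (hg : Continuous g) (hk : Continuous k) {a : ℝ} {δ : Euc d}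
    (h : ∀ x, g (x + δ) ≤ k x + a) (x : Euc d) : mollify φ g (x + δ) ≤ mollify φ k x + a := by
  have h1 : mollify φ k x + a = ∫ t, φ.normed volume t * (k (x - t) + a) := by
    simp only [mollify, mul_add]
    rw [integral_add (integrable_normed_mul hk x) (φ.integrable_normed.mul_const a),
      integral_mul_const, φ.integral_normed, one_mul]
  rw [h1]
  refine integral_mono (integrable_normed_mul hg _) ?_ fun t => ?_
  · exact integrable_normed_mul (g := fun y => k y + a) (by fun_prop) x
  · refine mul_le_mul_of_nonneg_left ?_ (φ.nonneg_normed t)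
    rw [add_sub_right_comm]
    exact h _

lemma lipschitzWith_mollify {L : NNReal} (hL : LipschitzWith L g) :
    LipschitzWith L (mollify φ g) := by
  refine LipschitzWith.of_le_add_mul L fun x y => ?_
  have h := mollify_add_le (φ := φ) (δ := x - y) (a := L * dist x y) hL.continuous hL.continuous
    (fun z => by
      have := hL.le_add_mul (z + (x - y)) z
      rwa [dist_self_add_left, ← dist_eq_norm] at this) y
  rwa [add_sub_cancel] at h

lemma abs_mollify_sub_le {L : NNReal} (hL : LipschitzWith L g) (x : Euc d) :
    |mollify φ g x - g x| ≤ L * φ.rOut := by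
  rw [← Real.dist_eq, mollify_eq_convolution]
  refine φ.dist_normed_convolution_le hL.continuous.aestronglyMeasurable fun y hy => ?_
  exact (hL.dist_le_mul y x).trans (mul_le_mul_of_nonneg_left (Metric.mem_ball.1 hy).le
    L.coe_nonneg)

lemma fderiv_mollify (hg : Continuous g) (x : Euc d) : fderiv ℝ (mollify φ g) x =
    ∫ t, g (x - t) • fderiv ℝ (φ.normed volume) t := by
  have h := (φ.hasCompactSupport_normed (μ := volume)).hasFDerivAt_convolution_left
    (ContinuousLinearMap.lsmul ℝ ℝ) (φ.contDiff_normed) (hg.locallyIntegrable (μ := volume)) x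
  rw [mollify_eq_convolution, h.fderiv]
  refine integral_congr_ae (Filter.Eventually.of_forall fun t => ?_)
  ext v
  simp [ContinuousLinearMap.precompL_apply, mul_comm]

/-- The derivative is put on the bump, so `C` depends on `φ` and `L` alone. This uniformity gives
all Hopf–Lax times the same error constant. -/
lemma exists_lipschitzWith_fderiv_mollify (φ : ContDiffBump (0 : Euc d)) (L : NNReal) :
    ∃ C : NNReal, ∀ g : Euc d → ℝ, LipschitzWith L g →
      LipschitzWith C (fderiv ℝ (mollify φ g)) := by
  have hcs : HasCompactSupport (fderiv ℝ (φ.normed volume)) :=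
    φ.hasCompactSupport_normed.fderiv ℝ
  have hcont : Continuous (fderiv ℝ (φ.normed volume)) :=
    (φ.contDiff_normed (n := 1)).continuous_fderiv one_ne_zero
  have hint : Integrable (fderiv ℝ (φ.normed volume)) :=
    hcont.integrable_of_hasCompactSupport hcs
  refine ⟨L * (∫ t, ‖fderiv ℝ (φ.normed volume) t‖).toNNReal,
    fun g hg => LipschitzWith.of_dist_le_mul fun x y => ?_⟩
  have hi : ∀ z, Integrable fun t => g (z - t) • fderiv ℝ (φ.normed volume) t := fun z =>
    ((hg.continuous.comp (by fun_prop)).smul hcont).integrable_of_hasCompactSupport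
      (hcs.smul_left)
  rw [dist_eq_norm, fderiv_mollify hg.continuous, fderiv_mollify hg.continuous,
    ← integral_sub (hi x) (hi y)]
  refine (norm_integral_le_of_norm_le (hint.norm.const_mul (L * dist x y))
    (Filter.Eventually.of_forall fun t => ?_)).trans (le_of_eq ?_)
  · rw [← sub_smul, norm_smul, ← dist_eq_norm]
    have := hg.dist_le_mul (x - t) (y - t)
    rw [dist_sub_right] at this
    gcongr
  · rw [integral_const_mul, NNReal.coe_mul,
      Real.coe_toNNReal _ (integral_nonneg fun _ => norm_nonneg _)]
    ring

end Mollify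

/-! ### From weak speed to the Wasserstein bound -/

section SpeedBound

variable {d : ℕ} {ν : ℝ → Measure (Euc d)} {m : ℝ → ℝ} {s t : ℝ}

/-- In the weak sense, the curve `ν` has on `[s, t]` a velocity field whose `L²(ν_r)`
norm is at most `m r`. -/
def HasWeakSpeed (ν : ℝ → Measure (Euc d)) (m : ℝ → ℝ) (s t : ℝ) : Prop :=
  ∀ η : Euc d → ℝ, ContDiff ℝ ∞ η → HasCompactSupport η → ∀ a b, s ≤ a → a ≤ b → b ≤ t →
    ∫ x, η x ∂(ν b) - ∫ x, η x ∂(ν a) ≤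
      ∫ r in a..b, m r * √(∫ x, ‖fderiv ℝ η x‖ ^ 2 ∂(ν r))

/-- The squared norm of the derivative. -/
noncomputable def sqNormFDeriv (U : Euc d → ℝ) (x : Euc d) : ℝ := ‖fderiv ℝ U x‖ ^ 2

lemma contDiff_sqNormFDeriv {U : Euc d → ℝ} (hU : ContDiff ℝ ∞ U) :
    ContDiff ℝ ∞ (sqNormFDeriv U) := by
  have h1 : ContDiff ℝ ∞ (fderiv ℝ U) := hU.fderiv_right (by simp)
  have h2 : ContDiff ℝ ∞ fun x => (InnerProductSpace.toDual ℝ (Euc d)).symm (fderiv ℝ U x) :=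
    (InnerProductSpace.toDual ℝ (Euc d)).symm.contDiff.comp h1
  have h3 := h2.norm_sq ℝ
  simp only [LinearIsometryEquiv.norm_map] at h3
  exact h3

lemma fderiv_sub_const_fun (U : Euc d → ℝ) (c : ℝ) :
    fderiv ℝ (fun x => U x - c) = fderiv ℝ U := by
  ext1 x; exact fderiv_sub_const c

lemma hasCompactSupport_fderiv_of_sub_const {U : Euc d → ℝ} {c : ℝ}
    (hc : HasCompactSupport fun x => U x - c) : HasCompactSupport (fderiv ℝ U) := by
  rw [← fderiv_sub_const_fun U c]
  exact hc.fderiv ℝ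

lemma hasCompactSupport_sqNormFDeriv {U : Euc d → ℝ} {c : ℝ}
    (hc : HasCompactSupport fun x => U x - c) : HasCompactSupport (sqNormFDeriv U) :=
  (hasCompactSupport_fderiv_of_sub_const hc).comp_left
    (g := fun D : Euc d →L[ℝ] ℝ => ‖D‖ ^ 2) (by simp)

lemma lipschitzWith_sqNormFDeriv {U : Euc d → ℝ} {L L₂ : NNReal} (hL : LipschitzWith L U)
    (hL₂ : LipschitzWith L₂ (fderiv ℝ U)) : LipschitzWith (2 * L * L₂) (sqNormFDeriv U) := by
  refine LipschitzWith.of_dist_le_mul fun x y => ?_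
  have hx := norm_fderiv_le_of_lipschitz ℝ hL (x₀ := x)
  have hy := norm_fderiv_le_of_lipschitz ℝ hL (x₀ := y)
  have hxy := hL₂.dist_le_mul x y
  rw [dist_eq_norm] at hxy
  have h1 := abs_norm_sub_norm_le (fderiv ℝ U x) (fderiv ℝ U y)
  rw [Real.dist_eq, sqNormFDeriv, sqNormFDeriv, sq_sub_sq, abs_mul,
    abs_of_nonneg (by positivity)]
  push_cast
  calc (‖fderiv ℝ U x‖ + ‖fderiv ℝ U y‖) * |‖fderiv ℝ U x‖ - ‖fderiv ℝ U y‖|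
      ≤ (L + L) * (L₂ * dist x y) := by gcongr; exact h1.trans hxy
    _ = _ := by ring

/-- A Hamilton–Jacobi step inequality, with an error quadratic in the step. -/
lemma le_sub_of_hamiltonJacobi_step {U V : Euc d → ℝ} (hU : ContDiff ℝ ∞ U) {L L₂ : NNReal}
    (hL : LipschitzWith L U) (hL₂ : LipschitzWith L₂ (fderiv ℝ U)) {h : ℝ}
    (hV : ∀ x p, V (x + h • p) ≤ U x + h * ‖p‖ ^ 2 / 2) (x : Euc d) :
    V x ≤ U x - h / 2 * sqNormFDeriv U x + L₂ * L ^ 2 * h ^ 2 := by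
  set p := (InnerProductSpace.toDual ℝ (Euc d)).symm (fderiv ℝ U x) with hp
  have hpn : ‖p‖ = ‖fderiv ℝ U x‖ := LinearIsometryEquiv.norm_map _ _
  have hDp : fderiv ℝ U x p = ‖p‖ ^ 2 := by
    rw [← real_inner_self_eq_norm_sq]
    conv_rhs => rw [hp]
    rw [InnerProductSpace.toDual_symm_apply]
  -- The optimal direction is the gradient `p`. Taylor expansion gives `U (x - h p) ≈ U x - h ‖p‖²`,
  -- and adding the cost `h ‖p‖² / 2` leaves `-h ‖p‖² / 2`.
  have h1 := hV (x - h • p) p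
  rw [sub_add_cancel] at h1
  have hd : Differentiable ℝ U := hU.differentiable (by simp)
  have h2 := (convex_closedBall x ‖h • p‖).norm_image_sub_le_of_norm_hasFDerivWithin_le'
    (f := U) (f' := fderiv ℝ U) (φ := fderiv ℝ U x) (C := L₂ * ‖h • p‖)
    (fun z _ => (hd z).hasFDerivAt.hasFDerivWithinAt)
    (fun z hz => by
      rw [← dist_eq_norm]
      exact (hL₂.dist_le_mul z x).trans
        (mul_le_mul_of_nonneg_left (Metric.mem_closedBall.1 hz) L₂.coe_nonneg))
    (Metric.mem_closedBall_self (norm_nonneg _))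
    (y := x - h • p) (by simp)
  rw [sub_sub_cancel_left, map_neg, map_smul, hDp, norm_neg, norm_smul, Real.norm_eq_abs,
    Real.norm_eq_abs, smul_eq_mul] at h2
  have h3 := (abs_le.1 h2).2
  have h4 : L₂ * (|h| * ‖p‖) * (|h| * ‖p‖) ≤ L₂ * L ^ 2 * h ^ 2 := by
    have h5 : ‖p‖ ≤ L := hpn ▸ norm_fderiv_le_of_lipschitz ℝ hL
    calc (L₂ : ℝ) * (|h| * ‖p‖) * (|h| * ‖p‖) = L₂ * ‖p‖ ^ 2 * |h| ^ 2 := by ring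
      _ ≤ L₂ * L ^ 2 * |h| ^ 2 := by gcongr
      _ = _ := by rw [sq_abs]
  rw [sqNormFDeriv, ← hpn]
  linarith

variable [∀ r, IsProbabilityMeasure (ν r)]

lemma integrable_of_sub_const {U : Euc d → ℝ} (hU : Continuous U) {c : ℝ}
    (hc : HasCompactSupport fun x => U x - c) (r : ℝ) : Integrable U (ν r) := by
  have h := (hU.sub (continuous_const (y := c))).integrable_of_hasCompactSupport (μ := ν r) hc
  simpa using h.add (integrable_const c)

lemma HasWeakSpeed.sub_const (H : HasWeakSpeed ν m s t) {U : Euc d → ℝ} (hU : ContDiff ℝ ∞ U)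
    {c : ℝ} (hc : HasCompactSupport fun x => U x - c) {a b : ℝ} (ha : s ≤ a) (hab : a ≤ b)
    (hb : b ≤ t) : ∫ x, U x ∂(ν b) - ∫ x, U x ∂(ν a) ≤
      ∫ r in a..b, m r * √(∫ x, sqNormFDeriv U x ∂(ν r)) := by
  have h := H _ (hU.sub contDiff_const) hc a b ha hab hb
  simp only [fderiv_sub_const_fun] at h
  rw [integral_sub (integrable_of_sub_const hU.continuous hc b) (integrable_const c),
    integral_sub (integrable_of_sub_const hU.continuous hc a) (integrable_const c)] at h
  simpa [sqNormFDeriv] using h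

lemma intervalIntegrable_add_one_of_le (hm : IntervalIntegrable m volume s t) {a b : ℝ}
    (ha : s ≤ a) (hab : a ≤ b) (hb : b ≤ t) :
    IntervalIntegrable (fun r => m r + 1) volume a b :=
  (hm.mono_set (by
    rw [Set.uIcc_of_le hab, Set.uIcc_of_le (ha.trans (hab.trans hb))]
    exact Set.Icc_subset_Icc ha hb)).add intervalIntegrable_const

lemma HasWeakSpeed.integral_sub_le_lipschitz (hm0 : ∀ r, 0 ≤ m r)
    (hm : IntervalIntegrable m volume s t) (H : HasWeakSpeed ν m s t) {q : Euc d → ℝ}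
    (hq : ContDiff ℝ ∞ q) (hqc : HasCompactSupport q) {L : NNReal} (hL : LipschitzWith L q)
    {a b : ℝ} (ha : s ≤ a) (hab : a ≤ b) (hb : b ≤ t) :
    ∫ x, q x ∂(ν b) - ∫ x, q x ∂(ν a) ≤ L * ∫ r in a..b, (m r + 1) := by
  refine (H q hq hqc a b ha hab hb).trans ?_
  rw [← intervalIntegral.integral_const_mul, intervalIntegral.integral_of_le hab,
    intervalIntegral.integral_of_le hab]
  refine integral_mono_of_nonneg (Filter.Eventually.of_forall fun r =>
    mul_nonneg (hm0 r) (Real.sqrt_nonneg _))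
    ((intervalIntegrable_add_one_of_le hm ha hab hb).const_mul _).1
    (Filter.Eventually.of_forall fun r => ?_)
  have h1 : √(∫ x, ‖fderiv ℝ q x‖ ^ 2 ∂(ν r)) ≤ L := by
    refine Real.sqrt_le_iff.2 ⟨L.coe_nonneg, ?_⟩
    have h2 : ∫ x, ‖fderiv ℝ q x‖ ^ 2 ∂(ν r) ≤ ∫ _, (L : ℝ) ^ 2 ∂(ν r) :=
      integral_mono_of_nonneg (Filter.Eventually.of_forall fun x => by positivity)
        (integrable_const _) (Filter.Eventually.of_forall fun x => by
          have := norm_fderiv_le_of_lipschitz ℝ hL (x₀ := x)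
          dsimp only
          gcongr)
    simpa using h2
  have := mul_le_mul_of_nonneg_left h1 (hm0 r)
  dsimp only
  nlinarith [L.coe_nonneg]

/-- One step of the Hopf–Lax comparison along a curve. -/
lemma HasWeakSpeed.integral_sub_le_step (hm0 : ∀ r, 0 ≤ m r)
    (hm : IntervalIntegrable m volume s t) (H : HasWeakSpeed ν m s t) {U V : Euc d → ℝ}
    (hU : ContDiff ℝ ∞ U) {c : ℝ} (hc : HasCompactSupport fun x => U x - c) {L L₂ : NNReal}
    (hL : LipschitzWith L U) (hL₂ : LipschitzWith L₂ (fderiv ℝ U)) {a b h : ℝ} (ha : s ≤ a)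
    (hab : a ≤ b) (hb : b ≤ t) (hh : ∫ r in a..b, (m r + 1) = h)
    (hVi : Integrable V (ν b)) (hV : ∀ x p, V (x + h • p) ≤ U x + h * ‖p‖ ^ 2 / 2) :
    ∫ x, V x ∂(ν b) - ∫ x, U x ∂(ν a) ≤ h / 2 + (L₂ * L ^ 2 + L * L₂) * h ^ 2 := by
  set q := sqNormFDeriv U
  have hqs : ContDiff ℝ ∞ q := contDiff_sqNormFDeriv hU
  have hqc : HasCompactSupport q := hasCompactSupport_sqNormFDeriv hc
  have hqL : LipschitzWith (2 * L * L₂) q := lipschitzWith_sqNormFDeriv hL hL₂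
  have hqi : ∀ r, Integrable q (ν r) := fun r =>
    hqs.continuous.integrable_of_hasCompactSupport hqc
  have hUi := integrable_of_sub_const (ν := ν) hU.continuous hc b
  have hint := intervalIntegrable_add_one_of_le hm ha hab hb
  have h0 : 0 ≤ h := hh ▸ intervalIntegral.integral_nonneg hab fun r _ => by linarith [hm0 r]
  have h1 : ∫ x, V x ∂(ν b) ≤
      ∫ x, U x ∂(ν b) - h / 2 * ∫ x, q x ∂(ν b) + L₂ * L ^ 2 * h ^ 2 := by
    have h2 : ∫ x, V x ∂(ν b) ≤ ∫ x, (U x - h / 2 * q x + L₂ * L ^ 2 * h ^ 2) ∂(ν b) :=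
      integral_mono hVi ((hUi.sub ((hqi b).const_mul _)).add (integrable_const _))
        (le_sub_of_hamiltonJacobi_step hU hL hL₂ hV)
    have hi : Integrable (fun x => U x - h / 2 * q x) (ν b) := hUi.sub ((hqi b).const_mul _)
    rw [integral_add hi (integrable_const _), integral_sub hUi ((hqi b).const_mul _),
      integral_const_mul] at h2
    simpa using h2
  have h3 := H.sub_const hU hc ha hab hb
  -- The gain in `h1` involves `q` at time `b`, the loss in `h3` at all times `r`. Applying the weak
  -- speed bound to `-q` compares them up to an error of order `h`.
  have h4 : ∀ r, a ≤ r → r ≤ b → ∫ x, q x ∂(ν r) ≤ ∫ x, q x ∂(ν b) + 2 * L * L₂ * h := by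
    intro r har hrb
    have h5 := H.integral_sub_le_lipschitz hm0 hm (q := fun x => -q x) hqs.neg
      (hqc.comp_left (g := fun y : ℝ => -y) neg_zero) (L := 2 * L * L₂)
      (LipschitzWith.of_dist_le_mul fun x y => by
        rw [dist_neg_neg]; exact hqL.dist_le_mul x y) (ha.trans har) hrb hb
    rw [integral_neg, integral_neg] at h5
    have h6 : ∫ r in r..b, (m r + 1) ≤ h := by
      rw [← hh, ← intervalIntegral.integral_add_adjacent_intervals
        (intervalIntegrable_add_one_of_le hm ha har (hrb.trans hb))
        (intervalIntegrable_add_one_of_le hm (ha.trans har) hrb hb)]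
      linarith [intervalIntegral.integral_nonneg (μ := volume) har
        fun r _ => add_nonneg (hm0 r) zero_le_one]
    have h7 := mul_le_mul_of_nonneg_left h6 (2 * L * L₂).coe_nonneg
    push_cast at h5 h7
    linarith
  set Q := ∫ x, q x ∂(ν b) with hQ
  have h5 : ∫ r in a..b, m r * √(∫ x, q x ∂(ν r)) ≤ (Q + 2 * L * L₂ * h + 1) / 2 * h := by
    rw [← hh, ← intervalIntegral.integral_const_mul, hh, intervalIntegral.integral_of_le hab,
      intervalIntegral.integral_of_le hab]
    refine integral_mono_of_nonneg (Filter.Eventually.of_forall fun r =>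
      mul_nonneg (hm0 r) (Real.sqrt_nonneg _)) (hint.const_mul _).1
      (ae_restrict_of_forall_mem measurableSet_Ioc fun r hr => ?_)
    have h6 := h4 r hr.1.le hr.2
    have h7 : √(∫ x, q x ∂(ν r)) ≤ (∫ x, q x ∂(ν r) + 1) / 2 := by
      have h8 : 0 ≤ ∫ x, q x ∂(ν r) := integral_nonneg fun x => by
        simp only [q, sqNormFDeriv]; positivity
      nlinarith [Real.sq_sqrt h8, sq_nonneg (√(∫ x, q x ∂(ν r)) - 1)]
    dsimp only
    have h8 := Real.sqrt_nonneg (∫ x, q x ∂(ν r))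
    calc m r * √(∫ x, q x ∂(ν r)) ≤ (m r + 1) * √(∫ x, q x ∂(ν r)) := by
          gcongr; linarith
      _ ≤ (m r + 1) * ((Q + 2 * L * L₂ * h + 1) / 2) := by
          gcongr
          · linarith [hm0 r]
          · linarith
      _ = _ := by ring
  -- The terms `-h Q / 2` from `h1` and `h Q / 2` from `h5` cancel, leaving `h / 2` and quadratic
  -- errors.
  nlinarith

/-- A function whose increments are bounded by `ω / 2 + C ω²` in terms of the increments `ω` of a
continuous function has increments at most `ω / 2`. -/
lemma sub_le_of_sub_le_add_sq {F θ : ℝ → ℝ} {C : ℝ} (hθ : ContinuousOn θ (Set.Icc s t))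
    (hF : ∀ a b, s ≤ a → a ≤ b → b ≤ t →
      F b - F a ≤ (θ b - θ a) / 2 + C * (θ b - θ a) ^ 2)
    (hmono : MonotoneOn θ (Set.Icc s t)) (hst : s ≤ t) : F t - F s ≤ (θ t - θ s) / 2 := by
  have key : ∀ n : ℕ, ∀ a b, s ≤ a → a ≤ b → b ≤ t →
      F b - F a ≤ (θ b - θ a) / 2 + C * (θ b - θ a) ^ 2 * (1 / 2) ^ n := by
    intro n
    induction n with
    | zero => simpa using hF
    | succ n ih =>
      intro a b ha hab hb
      have hle := hmono ⟨ha, hab.trans hb⟩ ⟨ha.trans hab, hb⟩ hab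
      -- Bisecting in the value of `θ` rather than in time halves the quadratic error: `2 C (ω / 2)²
      -- = C ω² / 2`.
      obtain ⟨r, hr, hrθ⟩ := intermediate_value_Icc hab
        (hθ.mono (Set.Icc_subset_Icc ha hb)) (show (θ a + θ b) / 2 ∈ Set.Icc (θ a) (θ b) from
          ⟨by linarith, by linarith⟩)
      have h1 := ih a r ha hr.1 (hr.2.trans hb)
      have h2 := ih r b (ha.trans hr.1) hr.2 hb
      rw [hrθ] at h1 h2
      rw [show (1 / 2 : ℝ) ^ (n + 1) = (1 / 2) ^ n * (1 / 2) from pow_succ _ _]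
      linarith
  have hlim : Filter.Tendsto (fun n : ℕ => (θ t - θ s) / 2 + C * (θ t - θ s) ^ 2 * (1 / 2) ^ n)
      Filter.atTop (nhds ((θ t - θ s) / 2 + C * (θ t - θ s) ^ 2 * 0)) :=
    ((tendsto_pow_atTop_nhds_zero_of_lt_one (by norm_num) (by norm_num)).const_mul _).const_add _
  rw [mul_zero, add_zero] at hlim
  exact ge_of_tendsto' hlim fun n => key n s t le_rfl hst le_rfl

/-- The step inequality is applied to the mollified semigroup on the clock `θ(r) = ∫_s^r (m + 1)`,
where bisection removes its error. Mollification at scale `ε` costs `L ε` at each end, uniformly in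
time, and `ε → 0` comes last. -/
lemma HasWeakSpeed.integral_hopfLax_sub_le (hm0 : ∀ r, 0 ≤ m r)
    (hm : IntervalIntegrable m volume s t) (hst : s ≤ t) (H : HasWeakSpeed ν m s t)
    {f : Euc d → ℝ} (hf : f ∈ lipConstAtInfty (Euc d)) {T : ℝ}
    (hT : ∫ r in s..t, (m r + 1) = T) :
    ∫ x, hopfLax f T x ∂(ν t) - ∫ x, f x ∂(ν s) ≤ T / 2 := by
  obtain ⟨M, hM⟩ := exists_neg_le_of_mem_lipConstAtInfty hf
  obtain ⟨L, hL⟩ := hf.1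
  set θ : ℝ → ℝ := fun r => ∫ u in s..r, (m u + 1) with hθ
  have hint : ∀ a b, s ≤ a → a ≤ b → b ≤ t → IntervalIntegrable (fun r => m r + 1) volume a b :=
    fun a b => intervalIntegrable_add_one_of_le hm
  have hθsub : ∀ a b, s ≤ a → a ≤ b → b ≤ t → ∫ u in a..b, (m u + 1) = θ b - θ a :=
    fun a b ha hab hb => (intervalIntegral.integral_interval_sub_left
      (hint s b le_rfl (ha.trans hab) hb) (hint s a le_rfl ha (hab.trans hb))).symm
  have hmono : MonotoneOn θ (Set.Icc s t) := fun a ha b hb hab => by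
    rw [← sub_nonneg, ← hθsub a b ha.1 hab hb.2]
    exact intervalIntegral.integral_nonneg hab fun r _ => add_nonneg (hm0 r) zero_le_one
  have hθ0 : θ s = 0 := by simp [hθ]
  have hθnn : ∀ a, s ≤ a → a ≤ t → 0 ≤ θ a := fun a ha hat =>
    hθ0 ▸ hmono ⟨le_rfl, hst⟩ ⟨ha, hat⟩ ha
  have hcont : ContinuousOn θ (Set.Icc s t) := by
    have := intervalIntegral.continuousOn_primitive_interval' (hint s t le_rfl hst le_rfl)
      (Set.left_mem_uIcc)
    rwa [Set.uIcc_of_le hst] at this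
  have key : ∀ ε : ℝ, 0 < ε →
      ∫ x, hopfLax f T x ∂(ν t) - ∫ x, f x ∂(ν s) ≤ T / 2 + 2 * L * ε := by
    intro ε hε
    let φ : ContDiffBump (0 : Euc d) := ⟨ε / 2, ε, half_pos hε, half_lt_self hε⟩
    obtain ⟨L₂, hL₂⟩ := exists_lipschitzWith_fderiv_mollify φ L
    have hu : ∀ τ, 0 ≤ τ → hopfLax f τ ∈ lipConstAtInfty (Euc d) := fun τ =>
      hopfLax_mem_lipConstAtInfty hf
    have huL : ∀ τ, 0 ≤ τ → LipschitzWith L (hopfLax f τ) := fun τ hτ =>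
      lipschitzWith_hopfLax hM hτ hL
    let U : ℝ → Euc d → ℝ := fun τ => mollify φ (hopfLax f τ)
    have hUi : ∀ τ, 0 ≤ τ → ∀ r, Integrable (U τ) (ν r) := fun τ hτ r => by
      obtain ⟨c, hc⟩ := (hu τ hτ).2
      exact integrable_of_sub_const (contDiff_mollify (huL τ hτ).continuous).continuous
        (hasCompactSupport_mollify_sub_const (huL τ hτ).continuous hc) r
    have hstep := sub_le_of_sub_le_add_sq (F := fun r => ∫ x, U (θ r) x ∂(ν r))
      (C := L₂ * L ^ 2 + L * L₂) hcont (fun a b ha hab hb => ?_) hmono hst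
    · have hTθ : θ t = T := hT
      have hclose : ∀ τ, 0 ≤ τ → ∀ r, |∫ x, U τ x ∂(ν r) - ∫ x, hopfLax f τ x ∂(ν r)| ≤
          L * ε := by
        intro τ hτ r
        rw [← integral_sub (hUi τ hτ r) (integrable_of_mem_lipConstAtInfty (hu τ hτ) _)]
        have := norm_integral_le_of_norm_le_const (μ := ν r) (C := L * ε)
          (f := fun x => U τ x - hopfLax f τ x)
          (Filter.Eventually.of_forall fun x => abs_mollify_sub_le (huL τ hτ) x)
        simpa using this
      have h1 := abs_le.1 (hclose T (hTθ ▸ hθnn t hst le_rfl) t)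
      have h2 := abs_le.1 (hclose 0 le_rfl s)
      simp only [hθ0, hTθ, hopfLax_zero] at hstep h2
      linarith
    · have ha0 := hθnn a ha (hab.trans hb)
      obtain ⟨c, hc⟩ := (hu _ ha0).2
      have hle : 0 ≤ θ b - θ a := sub_nonneg.2
        (hmono ⟨ha, hab.trans hb⟩ ⟨ha.trans hab, hb⟩ hab)
      refine H.integral_sub_le_step hm0 hm (contDiff_mollify (huL _ ha0).continuous)
        (hasCompactSupport_mollify_sub_const (huL _ ha0).continuous hc)
        (lipschitzWith_mollify (huL _ ha0)) (hL₂ _ (huL _ ha0)) ha hab hb (hθsub a b ha hab hb)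
        (hUi _ (hθnn b (ha.trans hab) hb) b) fun x p => ?_
      refine mollify_add_le (huL _ (hθnn b (ha.trans hab) hb)).continuous
        (huL _ ha0).continuous (fun z => ?_) x
      have := hopfLax_add_le hM ha0 hle z p
      rwa [add_sub_cancel] at this
  refine le_of_forall_pos_le_add fun δ hδ => ?_
  refine (key (δ / (2 * L + 1)) (by positivity)).trans ?_
  have : 2 * (L : ℝ) * (δ / (2 * L + 1)) ≤ δ := by
    rw [mul_div_assoc', div_le_iff₀ (by positivity)]
    nlinarith [L.coe_nonneg]
  linarith

lemma W2_self (μ : Measure (Euc d)) : W2 μ μ = 0 := by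
  refine le_antisymm (iInf₂_le_of_le (μ.map fun x => (x, x)) ⟨?_, ?_⟩ ?_) zero_le
  · rw [Measure.map_map measurable_fst (by fun_prop)]
    exact Measure.map_id
  · rw [Measure.map_map measurable_snd (by fun_prop)]
    exact Measure.map_id
  · rw [eLpNorm_map_measure (by fun_prop) (by fun_prop)]
    simp [Function.comp_def]

/-- A weakly differentiable curve satisfies the Wasserstein bound given by its speed. -/
theorem HasWeakSpeed.W2_le (hm0 : ∀ r, 0 ≤ m r) (hm : IntervalIntegrable m volume s t)
    (hst : s ≤ t) (H : HasWeakSpeed ν m s t) :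
    W2 (ν s) (ν t) ≤ ENNReal.ofReal (∫ r in s..t, (m r + 1)) := by
  rcases hst.eq_or_lt with rfl | hlt
  · simp [W2_self]
  set T := ∫ r in s..t, (m r + 1) with hT
  have hTpos : 0 < T := by
    refine lt_of_lt_of_le (sub_pos.2 hlt) ?_
    have := intervalIntegral.integral_mono_on hst intervalIntegrable_const
      (intervalIntegrable_add_one_of_le hm le_rfl hst le_rfl) (f := fun _ => (1 : ℝ))
      (fun r _ => by linarith [hm0 r])
    simpa using this
  have hdual : ∀ f ∈ lipConstAtInfty (Euc d), ∀ g ∈ lipConstAtInfty (Euc d),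
      (∀ x y, f x + g y ≤ ‖x - y‖ ^ 2) → ∫ x, f x ∂(ν s) + ∫ y, g y ∂(ν t) ≤ T ^ 2 := by
    intro f hf g hg hfg
    -- The factor `1 / (2 T)` turns the quadratic cost of the displacement `T p` into the Hopf–Lax
    -- cost `T ‖p‖² / 2`, so `g / (2 T)` lies below the Hopf–Lax transform of `-f / (2 T)`.
    have hf' : (-(2 * T)⁻¹) • f ∈ lipConstAtInfty (Euc d) := Submodule.smul_mem _ _ hf
    obtain ⟨M, hM⟩ := exists_neg_le_of_mem_lipConstAtInfty hf'
    have h1 := H.integral_hopfLax_sub_le hm0 hm hst hf' hT.symm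
    have h2 : ∫ y, (2 * T)⁻¹ * g y ∂(ν t) ≤ ∫ y, hopfLax ((-(2 * T)⁻¹) • f) T y ∂(ν t) := by
      refine integral_mono ((integrable_of_mem_lipConstAtInfty hg _).const_mul _)
        (integrable_of_mem_lipConstAtInfty (hopfLax_mem_lipConstAtInfty hf' hTpos.le) _)
        fun y => le_ciInf fun p => ?_
      have h3 := hfg (y - T • p) y
      rw [sub_sub_cancel_left, norm_neg, norm_smul, Real.norm_of_nonneg hTpos.le] at h3
      have h4 : (2 * T)⁻¹ * (f (y - T • p) + g y) ≤ (2 * T)⁻¹ * (T * ‖p‖) ^ 2 :=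
        mul_le_mul_of_nonneg_left h3 (by positivity)
      have h5 : (2 * T)⁻¹ * (T * ‖p‖) ^ 2 = T * ‖p‖ ^ 2 / 2 := by field_simp
      simp only [Pi.smul_apply, smul_eq_mul]
      linarith
    simp only [Pi.smul_apply, smul_eq_mul, integral_const_mul] at h1 h2
    have h3 : (2 * T)⁻¹ * (∫ x, f x ∂(ν s) + ∫ y, g y ∂(ν t)) ≤ T / 2 := by linarith
    rw [inv_mul_le_iff₀ (by positivity)] at h3
    linarith
  obtain ⟨γ, hγ1, hγ2, hγ⟩ := exists_coupling_lintegral_le (c := fun p => ‖p.1 - p.2‖ ^ 2)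
    (by fun_prop) (fun p => by positivity) hdual
  refine iInf₂_le_of_le γ ⟨hγ1, hγ2⟩ ?_
  rw [eLpNorm_eq_lintegral_rpow_enorm_toReal two_ne_zero ENNReal.ofNat_ne_top]
  simp only [ENNReal.toReal_ofNat, ENNReal.rpow_ofNat]
  have h1 : ∫⁻ p : Euc d × Euc d, ‖p.1 - p.2‖ₑ ^ 2 ∂γ ≤ ENNReal.ofReal (T ^ 2) := by
    refine le_trans (le_of_eq (lintegral_congr fun p => ?_)) hγ
    rw [ENNReal.ofReal_pow (norm_nonneg _), ofReal_norm]
  refine (ENNReal.rpow_le_rpow h1 (by norm_num)).trans (le_of_eq ?_)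
  rw [ENNReal.ofReal_rpow_of_nonneg (by positivity) (by norm_num), ← Real.sqrt_eq_rpow,
    Real.sqrt_sq hTpos.le]

end SpeedBound

/-! ### Wasserstein bounds imply narrow continuity -/

section NarrowContinuity

variable {d : ℕ}

lemma isProbabilityMeasure_of_map_fst_eq {μ : Measure (Euc d)} [IsProbabilityMeasure μ]
    {γ : Measure (Euc d × Euc d)} (h : γ.map Prod.fst = μ) : IsProbabilityMeasure γ :=
  ⟨by rw [← Set.preimage_univ (f := Prod.fst), ← Measure.map_apply measurable_fst
    MeasurableSet.univ, h, measure_univ]⟩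

/-- For any coupling the difference of the integrals is at most `L` times the `L¹` cost, which is at
most the `L²` cost since couplings have mass one. -/
lemma ofReal_abs_integral_sub_div_le_W2 {μ ν : Measure (Euc d)} [IsProbabilityMeasure μ]
    [IsProbabilityMeasure ν] {f : Euc d → ℝ} {L : NNReal} (hL : LipschitzWith L f)
    (hμ : Integrable f μ) (hν : Integrable f ν) :
    ENNReal.ofReal |∫ x, f x ∂μ - ∫ x, f x ∂ν| / L ≤ W2 μ ν := by
  refine le_iInf₂ fun γ hγ => ENNReal.div_le_of_le_mul ?_
  have hp := isProbabilityMeasure_of_map_fst_eq hγ.1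
  have h1 : ∫ x, f x ∂μ = ∫ p, f p.1 ∂γ := by
    rw [← hγ.1, integral_map measurable_fst.aemeasurable hL.continuous.aestronglyMeasurable]
  have h2 : ∫ x, f x ∂ν = ∫ p, f p.2 ∂γ := by
    rw [← hγ.2, integral_map measurable_snd.aemeasurable hL.continuous.aestronglyMeasurable]
  have hi1 : Integrable (fun p => f p.1) γ := by
    rw [← hγ.1] at hμ
    exact hμ.comp_measurable measurable_fst
  have hi2 : Integrable (fun p => f p.2) γ := by
    rw [← hγ.2] at hν
    exact hν.comp_measurable measurable_snd
  rw [h1, h2, ← integral_sub hi1 hi2, ← Real.norm_eq_abs, ofReal_norm]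
  calc ‖∫ p, (f p.1 - f p.2) ∂γ‖ₑ ≤ ∫⁻ p, ‖f p.1 - f p.2‖ₑ ∂γ := enorm_integral_le_lintegral_enorm _
    _ ≤ ∫⁻ p, L * ‖p.1 - p.2‖ₑ ∂γ := by
        refine lintegral_mono fun p => ?_
        rw [← edist_eq_enorm_sub, ← edist_eq_enorm_sub]
        exact hL p.1 p.2
    _ = L * eLpNorm (fun p : Euc d × Euc d => p.1 - p.2) 1 γ := by
        rw [lintegral_const_mul' _ _ ENNReal.coe_ne_top, eLpNorm_one_eq_lintegral_enorm]
    _ ≤ L * eLpNorm (fun p : Euc d × Euc d => p.1 - p.2) 2 γ := by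
        gcongr
        exact eLpNorm_le_eLpNorm_of_exponent_le one_le_two
          (by fun_prop : Continuous fun p : Euc d × Euc d => p.1 - p.2).aestronglyMeasurable
    _ = _ := mul_comm _ _

lemma HasL1Speed.narrowlyContinuous {μ : I → Measure (Euc d)}
    (hμ : ∀ t, IsProbabilityMeasure (μ t)) (h : HasL1Speed μ) : NarrowlyContinuous μ := by
  obtain ⟨m, hm, hW⟩ := h
  have hcont : Continuous fun t : I => ∫ r in (0 : ℝ)..t, m r := by
    have h1 := intervalIntegral.continuousOn_primitive_interval (a := 0) (b := 1) (μ := volume)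
      (f := m) (by rwa [Set.uIcc_of_le zero_le_one])
    rw [Set.uIcc_of_le zero_le_one] at h1
    exact continuousOn_iff_continuous_domRestrict.1 h1
  let ρ : I → ProbabilityMeasure (Euc d) := fun t => ⟨μ t, hμ t⟩
  have hρ : Continuous ρ := by
    refine continuous_iff_continuousAt.2 fun t₀ => ?_
    refine tendsto_iff_forall_lipschitz_integral_tendsto.2 fun f ⟨C, hC⟩ ⟨L, hL⟩ => ?_
    have hfi : ∀ t, Integrable f (μ t) := fun t => by
      refine Integrable.of_bound hL.continuous.aestronglyMeasurable (‖f 0‖ + C)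
        (Filter.Eventually.of_forall fun x => ?_)
      have := hC x 0
      rw [dist_eq_norm] at this
      linarith [norm_sub_norm_le (f x) (f 0)]
    have key : ∀ s t : I, s ≤ t → |∫ x, f x ∂(μ s) - ∫ x, f x ∂(μ t)| ≤
        (L + 1) * |(∫ r in (0 : ℝ)..s, m r) - ∫ r in (0 : ℝ)..t, m r| := by
      intro s t hst
      -- The constant `L + 1` instead of `L` makes the division legitimate when `L = 0`.
      have h1 := (ofReal_abs_integral_sub_div_le_W2 (hL.weaken (le_add_of_nonneg_right zero_le_one))
        (hfi s) (hfi t)).trans (hW s t hst)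
      have hint : ∀ a : I, IntervalIntegrable m volume 0 a := fun a =>
        (hm.mono_set (by
          rw [Set.uIcc_of_le a.2.1]; exact Set.Icc_subset_Icc le_rfl a.2.2)).intervalIntegrable
      rw [← intervalIntegral.integral_interval_sub_left (hint t) (hint s),
        ENNReal.div_le_iff (by simp) (by simp)] at h1
      have h2 : ENNReal.ofReal |∫ x, f x ∂(μ s) - ∫ x, f x ∂(μ t)| ≤ ENNReal.ofReal
          ((L + 1) * |(∫ r in (0 : ℝ)..s, m r) - ∫ r in (0 : ℝ)..t, m r|) := by
        refine h1.trans ?_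
        rw [ENNReal.ofReal_mul (by positivity), mul_comm]
        refine mul_le_mul' (le_of_eq ?_) (ENNReal.ofReal_le_ofReal ?_)
        · rw [← NNReal.coe_one, ← NNReal.coe_add, ENNReal.ofReal_coe_nnreal]
        · rw [abs_sub_comm]; exact le_abs_self _
      exact (ENNReal.ofReal_le_ofReal_iff (by positivity)).1 h2
    have key' : ∀ s t : I, |∫ x, f x ∂(μ s) - ∫ x, f x ∂(μ t)| ≤
        (L + 1) * |(∫ r in (0 : ℝ)..s, m r) - ∫ r in (0 : ℝ)..t, m r| := by
      intro s t
      rcases le_total s t with hst | hst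
      · exact key s t hst
      · rw [abs_sub_comm, abs_sub_comm (∫ r in (0 : ℝ)..s, m r)]
        exact key t s hst
    refine tendsto_iff_dist_tendsto_zero.2 (squeeze_zero (fun _ => dist_nonneg)
      (fun t => key' t t₀) ?_)
    have h3 := (((hcont.sub continuous_const).abs).const_mul ((L : ℝ) + 1)).tendsto
      (f := fun t : I => ((L : ℝ) + 1) * |(∫ r in (0 : ℝ)..t, m r) - ∫ r in (0 : ℝ)..t₀, m r|) t₀
    rwa [sub_self, abs_zero, mul_zero] at h3
  intro f
  exact (ProbabilityMeasure.continuous_iff_forall_continuous_integral.1 hρ) f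

end NarrowContinuity

/-! ### The plans and a jointly measurable version of the kernels -/

section Plan

variable {d : ℕ}

lemma lintegral_plan (K : Kernel (Euc d) (Euc d)) [IsMarkovKernel K] (μ : Measure (Euc d))
    [SFinite μ] {f : Euc d × Euc d → ℝ≥0∞} (hf : Measurable f) :
    ∫⁻ p, f p ∂(plan K μ) = ∫⁻ y, ∫⁻ x, f (x, y) ∂(K y) ∂μ := by
  rw [plan, lintegral_map hf measurable_swap]
  exact Measure.lintegral_compProd (hf.comp measurable_swap)

lemma integral_plan (K : Kernel (Euc d) (Euc d)) [IsMarkovKernel K] (μ : Measure (Euc d))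
    [SFinite μ] {f : Euc d × Euc d → ℝ} (hf : StronglyMeasurable f)
    (hfi : Integrable f (plan K μ)) :
    ∫ p, f p ∂(plan K μ) = ∫ y, ∫ x, f (x, y) ∂(K y) ∂μ := by
  rw [plan, integral_map measurable_swap.aemeasurable hf.aestronglyMeasurable]
  exact Measure.integral_compProd (hfi.comp_measurable measurable_swap)

instance (K : Kernel (Euc d) (Euc d)) [IsMarkovKernel K] (μ : Measure (Euc d))
    [IsProbabilityMeasure μ] : IsProbabilityMeasure (plan K μ) :=
  Measure.isProbabilityMeasure_map measurable_swap.aemeasurable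

instance (K : Kernel (Euc d) (Euc d)) [IsMarkovKernel K] (μ : Measure (Euc d))
    [IsProbabilityMeasure μ] : IsProbabilityMeasure (firstMarginal K μ) :=
  Measure.isProbabilityMeasure_map measurable_fst.aemeasurable

variable {K : I → Kernel (Euc d) (Euc d)} [∀ t, IsMarkovKernel (K t)] {μ₁ : Measure (Euc d)}
  [IsProbabilityMeasure μ₁]

lemma narrowlyContinuous_plan (h : ∀ᵐ y ∂μ₁, NarrowlyContinuous fun t => K t y) :
    NarrowlyContinuous fun t => plan (K t) μ₁ := by
  intro f
  have h1 : ∀ t, ∫ p, f p ∂(plan (K t) μ₁) = ∫ y, ∫ x, f (x, y) ∂(K t y) ∂μ₁ := fun t =>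
    integral_plan _ _ f.continuous.stronglyMeasurable (f.integrable _)
  simp only [h1]
  refine continuous_of_dominated (bound := fun _ => ‖f‖) (fun t => ?_) (fun t => ?_)
    (integrable_const _) ?_
  · exact (StronglyMeasurable.integral_kernel_prod_right' (κ := K t)
      (f := fun p : Euc d × Euc d => f (p.2, p.1))
      (by fun_prop : Continuous fun p : Euc d × Euc d => f (p.2, p.1)).stronglyMeasurable
      ).aestronglyMeasurable
  · refine Filter.Eventually.of_forall fun y => ?_
    have := norm_integral_le_of_norm_le_const (μ := K t y) (f := fun x => f (x, y)) (C := ‖f‖)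
      (Filter.Eventually.of_forall fun x => f.norm_coe_le_norm _)
    simpa using this
  · filter_upwards [h] with y hy
    exact hy (f.compContinuous ⟨fun x => (x, y), by fun_prop⟩)

lemma narrowlyContinuous_firstMarginal (h : NarrowlyContinuous fun t => plan (K t) μ₁) :
    NarrowlyContinuous fun t => firstMarginal (K t) μ₁ := by
  intro f
  have h1 : ∀ t, ∫ x, f x ∂(firstMarginal (K t) μ₁) = ∫ p, f p.1 ∂(plan (K t) μ₁) := fun t =>
    integral_map measurable_fst.aemeasurable f.continuous.aestronglyMeasurable
  simp only [h1]
  exact h (f.compContinuous ⟨Prod.fst, continuous_fst⟩)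

/-- Integrals of bounded continuous functions are continuous in `t` and measurable in `y`, hence
jointly measurable. Thickened indicators pass this on to closed sets, a generating π-system. -/
lemma measurable_uncurry_of_narrowlyContinuous (h : ∀ y, NarrowlyContinuous fun t => K t y) :
    Measurable fun p : I × Euc d => K p.1 p.2 := by
  refine Measurable.measure_of_isPiSystem_of_isProbabilityMeasure
    (BorelSpace.measurable_eq.trans borel_eq_generateFrom_isClosed) isPiSystem_isClosed
    fun F hF => ?_
  have hpos : ∀ n : ℕ, 0 < 1 / ((n : ℝ) + 1) := fun n => by positivity
  have hlim : ∀ p : I × Euc d, Filter.Tendsto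
      (fun n : ℕ => ENNReal.ofReal (∫ x, (thickenedIndicator (hpos n) F x : ℝ) ∂(K p.1 p.2)))
      Filter.atTop (nhds (K p.1 p.2 F)) := fun p => by
    have h2 := (ENNReal.continuous_ofReal.tendsto _).comp
      (tendsto_integral_thickenedIndicator_of_isClosed (K p.1 p.2) hF hpos
        tendsto_one_div_add_atTop_nhds_zero_nat)
    rwa [ofReal_measureReal] at h2
  refine measurable_of_tendsto_metrizable (fun n => ?_) (tendsto_pi_nhds.2 hlim)
  refine Measurable.ennreal_ofReal ?_
  let g : BoundedContinuousFunction (Euc d) ℝ := BoundedContinuousFunction.mkOfBound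
    ⟨fun x => (thickenedIndicator (hpos n) F x : ℝ), by fun_prop⟩ 1 fun x y => by
      have h1 := thickenedIndicator_le_one (hpos n) F x
      have h2 := thickenedIndicator_le_one (hpos n) F y
      rw [Real.dist_eq, abs_le]
      constructor <;> simp only [ContinuousMap.coe_mk] <;>
        linarith [NNReal.coe_nonneg (thickenedIndicator (hpos n) F x),
          NNReal.coe_nonneg (thickenedIndicator (hpos n) F y),
          NNReal.coe_le_one.2 h1, NNReal.coe_le_one.2 h2]
  exact measurable_uncurry_of_continuous_of_measurable (u := fun t y => ∫ x, g x ∂(K t y))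
    (fun y => h y g) fun t => ((g.continuous.stronglyMeasurable.comp_measurable
      measurable_snd).integral_kernel_prod_right' (κ := K t)).measurable

/-- A family of Markov kernels that is a.e. narrowly continuous in time has a jointly measurable
version. -/
lemma exists_joint_kernel (h : ∀ᵐ y ∂μ₁, NarrowlyContinuous fun t => K t y) :
    ∃ κ : Kernel (I × Euc d) (Euc d), IsMarkovKernel κ ∧
      ∀ᵐ y ∂μ₁, ∀ t, κ (t, y) = K t y := by
  obtain ⟨N, hN, hNm, hN0⟩ := exists_measurable_superset_of_null (ae_iff.1 h)
  classical
  -- On the exceptional null set the kernels are replaced by a Dirac mass independent of `t`, so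
  -- that narrow continuity holds for every `y`.
  let K' : I → Kernel (Euc d) (Euc d) := fun t =>
    Kernel.piecewise hNm (Kernel.const _ (Measure.dirac 0)) (K t)
  have hK' : ∀ t, IsMarkovKernel (K' t) := fun t => inferInstance
  have hcont : ∀ y, NarrowlyContinuous fun t => K' t y := by
    intro y
    by_cases hy : y ∈ N
    · intro f
      simp only [K', Kernel.piecewise_apply, hy, if_true]
      exact continuous_const
    · simp only [K', Kernel.piecewise_apply, hy, if_false]
      by_contra hc
      exact hy (hN hc)
  refine ⟨⟨_, measurable_uncurry_of_narrowlyContinuous hcont⟩, ⟨fun p => ?_⟩, ?_⟩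
  · exact (hK' p.1).isProbabilityMeasure p.2
  · filter_upwards [measure_eq_zero_iff_ae_notMem.1 hN0] with y hy t
    change K' t y = K t y
    simp [K', Kernel.piecewise_apply, hy]

end Plan

/-! ### The du Bois-Reymond lemma -/

section DuBoisReymond

open Filter Topology

lemma deriv_smoothTransition_eq_zero {x : ℝ} (hx : x ∉ Set.Icc (0 : ℝ) 1) :
    deriv Real.smoothTransition x = 0 := by
  rw [Set.mem_Icc, not_and_or, not_le, not_le] at hx
  rcases hx with hx | hx
  · have : Real.smoothTransition =ᶠ[𝓝 x] fun _ => 0 := by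
      filter_upwards [Iio_mem_nhds hx] with y hy
      exact Real.smoothTransition.zero_of_nonpos (le_of_lt hy)
    rw [this.deriv_eq, deriv_const]
  · have : Real.smoothTransition =ᶠ[𝓝 x] fun _ => 1 := by
      filter_upwards [Ioi_mem_nhds hx] with y hy
      exact Real.smoothTransition.one_of_one_le (le_of_lt hy)
    rw [this.deriv_eq, deriv_const]

lemma hasCompactSupport_deriv_smoothTransition :
    HasCompactSupport (deriv Real.smoothTransition) :=
  HasCompactSupport.of_support_subset_isCompact (isCompact_Icc (a := (0 : ℝ)) (b := 1))
    fun _ hx => by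
      by_contra h
      exact hx (deriv_smoothTransition_eq_zero h)

lemma continuous_deriv_smoothTransition : Continuous (deriv Real.smoothTransition) :=
  (Real.smoothTransition.contDiff (n := 1)).continuous_deriv le_rfl

lemma integral_deriv_smoothTransition : ∫ x, deriv Real.smoothTransition x = 1 := by
  have h := integral_of_hasDerivAt_of_tendsto (f := Real.smoothTransition)
    (f' := deriv Real.smoothTransition) (m := 0) (n := 1)
    (fun x => ((Real.smoothTransition.contDiff (n := 1)).differentiable one_ne_zero
      x).hasDerivAt)
    (continuous_deriv_smoothTransition.integrable_of_hasCompactSupport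
      hasCompactSupport_deriv_smoothTransition)
    (tendsto_const_nhds.congr' (by
      filter_upwards [eventually_le_atBot 0] with x hx
      exact (Real.smoothTransition.zero_of_nonpos hx).symm))
    (tendsto_const_nhds.congr' (by
      filter_upwards [eventually_ge_atTop 1] with x hx
      exact (Real.smoothTransition.one_of_one_le hx).symm))
  simpa using h

/-- `n σ'(n (t - a))` is an approximation of the Dirac mass at `a`. -/
lemma tendsto_integral_deriv_smoothTransition {g : ℝ → ℝ} (hg : Continuous g) {C : ℝ}
    (hC : ∀ x, |g x| ≤ C) (a : ℝ) :
    Tendsto (fun n : ℕ => ∫ t, n * deriv Real.smoothTransition (n * (t - a)) * g t) atTop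
      (𝓝 (g a)) := by
  have h1 : ∀ᶠ n : ℕ in atTop, ∫ u, deriv Real.smoothTransition u * g (a + u / n) =
      ∫ t, n * deriv Real.smoothTransition (n * (t - a)) * g t := by
    filter_upwards [eventually_gt_atTop 0] with n hn
    have hn' : (0 : ℝ) < n := by exact_mod_cast hn
    have h2 := Measure.integral_comp_mul_left
      (fun u => deriv Real.smoothTransition u * g (a + u / n)) (n : ℝ)
    rw [← integral_sub_right_eq_self _ a, abs_of_pos (inv_pos.2 hn'), smul_eq_mul,
      eq_inv_mul_iff_mul_eq₀ hn'.ne', ← integral_const_mul] at h2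
    rw [← h2]
    refine integral_congr_ae (Eventually.of_forall fun t => ?_)
    dsimp only
    rw [mul_div_cancel_left₀ _ hn'.ne', add_sub_cancel, mul_assoc]
  refine Tendsto.congr' h1 ?_
  have h3 : ∫ u, deriv Real.smoothTransition u * g a = g a := by
    rw [integral_mul_const, integral_deriv_smoothTransition, one_mul]
  rw [← h3]
  refine tendsto_integral_of_dominated_convergence
    (fun u => ‖deriv Real.smoothTransition u‖ * C) (fun n => ?_) ?_ (fun n => ?_) ?_
  · exact (continuous_deriv_smoothTransition.mul (by fun_prop)).aestronglyMeasurable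
  · exact ((continuous_deriv_smoothTransition.integrable_of_hasCompactSupport
      hasCompactSupport_deriv_smoothTransition).norm).mul_const C
  · refine Eventually.of_forall fun u => ?_
    rw [norm_mul]
    exact mul_le_mul_of_nonneg_left (hC _) (norm_nonneg _)
  · refine Eventually.of_forall fun u => Tendsto.const_mul _ ?_
    have h4 : Tendsto (fun n : ℕ => a + u / n) atTop (𝓝 (a + 0)) :=
      (tendsto_const_div_atTop_nhds_zero_nat u).const_add a
    rw [add_zero] at h4
    exact (hg.tendsto a).comp h4

/-- A smooth approximation of the indicator function of `(a, b]`. -/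
noncomputable def smoothIndicator (a b : ℝ) (n : ℕ) (t : ℝ) : ℝ :=
  Real.smoothTransition (n * (t - a)) - Real.smoothTransition (n * (t - b))

lemma contDiff_smoothIndicator (a b : ℝ) (n : ℕ) : ContDiff ℝ ∞ (smoothIndicator a b n) :=
  (Real.smoothTransition.contDiff.comp (by fun_prop)).sub
    (Real.smoothTransition.contDiff.comp (by fun_prop))

lemma deriv_smoothIndicator (a b : ℝ) (n : ℕ) (t : ℝ) : deriv (smoothIndicator a b n) t =
    n * deriv Real.smoothTransition (n * (t - a)) -
      n * deriv Real.smoothTransition (n * (t - b)) := by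
  have h : ∀ c : ℝ, HasDerivAt (fun t => Real.smoothTransition (n * (t - c)))
      (n * deriv Real.smoothTransition (n * (t - c))) t := fun c => by
    have h1 := ((Real.smoothTransition.contDiff (n := 1)).differentiable one_ne_zero
      (n * (t - c))).hasDerivAt.comp t (((hasDerivAt_id t).sub_const c).const_mul (n : ℝ))
    rw [mul_one, mul_comm] at h1
    exact h1
  exact ((h a).sub (h b)).deriv

lemma abs_smoothIndicator_le (a b : ℝ) (n : ℕ) (t : ℝ) : |smoothIndicator a b n t| ≤ 1 := by
  rw [smoothIndicator, abs_le]
  constructor <;> linarith [Real.smoothTransition.nonneg (n * (t - a)),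
    Real.smoothTransition.le_one (n * (t - a)), Real.smoothTransition.nonneg (n * (t - b)),
    Real.smoothTransition.le_one (n * (t - b))]

lemma tsupport_smoothIndicator_subset {a b : ℝ} (hab : a ≤ b) {n : ℕ} (hn : 0 < n) :
    tsupport (smoothIndicator a b n) ⊆ Set.Icc a (b + 1 / n) := by
  have hn' : (0 : ℝ) < n := by exact_mod_cast hn
  refine closure_minimal (fun t ht => ?_) isClosed_Icc
  by_contra h
  rw [Set.mem_Icc, not_and_or, not_le, not_le] at h
  refine ht ?_
  rw [smoothIndicator]
  rcases h with h | h
  · rw [Real.smoothTransition.zero_of_nonpos, Real.smoothTransition.zero_of_nonpos, sub_zero] <;>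
      exact mul_nonpos_of_nonneg_of_nonpos hn'.le (by linarith)
  · have h1 : 1 ≤ n * (t - b) := by
      have := mul_le_mul_of_nonneg_left (le_of_lt (lt_sub_iff_add_lt'.2 h)) hn'.le
      rwa [mul_one_div_cancel hn'.ne'] at this
    have h2 : 1 ≤ n * (t - a) := h1.trans (mul_le_mul_of_nonneg_left (by linarith) hn'.le)
    rw [Real.smoothTransition.one_of_one_le h1, Real.smoothTransition.one_of_one_le h2, sub_self]

lemma tendsto_smoothTransition_mul {x : ℝ} : Tendsto (fun n : ℕ => Real.smoothTransition (n * x))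
    atTop (𝓝 (Set.indicator (Set.Ioi 0) 1 x)) := by
  refine tendsto_const_nhds.congr' ?_
  by_cases hx : 0 < x
  · obtain ⟨N, hN⟩ := exists_nat_ge x⁻¹
    filter_upwards [eventually_ge_atTop N] with n hn
    have hNn : (N : ℝ) ≤ n := by exact_mod_cast hn
    rw [Real.smoothTransition.one_of_one_le, Set.indicator_of_mem (by exact hx), Pi.one_apply]
    calc (1 : ℝ) = x⁻¹ * x := (inv_mul_cancel₀ hx.ne').symm
      _ ≤ n * x := by gcongr; exact hN.trans hNn
  · refine Eventually.of_forall fun n => ?_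
    dsimp only
    rw [Set.indicator_of_notMem (by exact hx), Real.smoothTransition.zero_of_nonpos]
    exact mul_nonpos_of_nonneg_of_nonpos n.cast_nonneg (not_lt.1 hx)

lemma tendsto_smoothIndicator {a b : ℝ} (hab : a ≤ b) (t : ℝ) :
    Tendsto (fun n => smoothIndicator a b n t) atTop (𝓝 (Set.indicator (Set.Ioc a b) 1 t)) := by
  have h := (tendsto_smoothTransition_mul (x := t - a)).sub
    (tendsto_smoothTransition_mul (x := t - b))
  suffices h' : Set.indicator (Set.Ioc a b) 1 t =
      Set.indicator (Set.Ioi (0 : ℝ)) 1 (t - a) -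
        Set.indicator (Set.Ioi (0 : ℝ)) (1 : ℝ → ℝ) (t - b) by
    rw [h']; exact h
  simp only [Set.indicator_apply, Set.mem_Ioc, Set.mem_Ioi, sub_pos, Pi.one_apply]
  by_cases h1 : a < t <;> by_cases h2 : b < t <;> simp [h1, h2, not_le.2, not_lt.1]
  all_goals linarith

/-- **Du Bois-Reymond lemma**: a continuous function with integrable weak derivative `h` on
`(0, 1)` is a primitive of `h`. -/
theorem sub_eq_integral_of_forall_integral_eq_zero {g h : ℝ → ℝ} (hg : Continuous g) {C : ℝ}
    (hC : ∀ x, |g x| ≤ C) (hh : IntervalIntegrable h volume 0 1)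
    (H : ∀ χ : ℝ → ℝ, ContDiff ℝ ∞ χ → HasCompactSupport χ → tsupport χ ⊆ Set.Ioo 0 1 →
      ∫ t in (0 : ℝ)..1, (deriv χ t * g t + χ t * h t) = 0)
    {a b : ℝ} (ha : 0 ≤ a) (hab : a ≤ b) (hb : b ≤ 1) : g b - g a = ∫ t in a..b, h t := by
  have hint : ∀ {a b : ℝ}, a ∈ Set.Icc (0 : ℝ) 1 → b ∈ Set.Icc (0 : ℝ) 1 →
      IntervalIntegrable h volume a b := fun ha hb => hh.mono_set (by
    rw [Set.uIcc_of_le zero_le_one]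
    exact Set.uIcc_subset_Icc ha hb)
  -- Interior endpoints come first: the smooth indicators are supported in `[a, b + 1/n]`, which
  -- must lie inside `(0, 1)`. Their derivatives tend to a Dirac mass at `a` minus one at `b`.
  have key : ∀ a b : ℝ, 0 < a → a ≤ b → b < 1 → g b - g a = ∫ t in a..b, h t := by
    intro a b ha hab hb
    have h1 : Tendsto (fun n : ℕ => ∫ t in (0 : ℝ)..1, smoothIndicator a b n t * h t) atTop
        (𝓝 (∫ t in (0 : ℝ)..1, Set.indicator (Set.Ioc a b) 1 t * h t)) := by
      refine intervalIntegral.tendsto_integral_filter_of_dominated_convergence (fun t => ‖h t‖)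
        (Eventually.of_forall fun n => ?_) (Eventually.of_forall fun n => ?_) hh.norm
        (Eventually.of_forall fun t _ => (tendsto_smoothIndicator hab t).mul_const _)
      · rw [Set.uIoc_of_le zero_le_one]
        exact (contDiff_smoothIndicator a b n).continuous.aestronglyMeasurable.mul
          hh.1.aestronglyMeasurable
      · refine Eventually.of_forall fun t _ => ?_
        rw [norm_mul]
        exact mul_le_of_le_one_left (norm_nonneg _) (abs_smoothIndicator_le a b n t)
    have h2 : ∫ t in (0 : ℝ)..1, Set.indicator (Set.Ioc a b) 1 t * h t = ∫ t in a..b, h t := by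
      have : ∀ t, Set.indicator (Set.Ioc a b) 1 t * h t = Set.indicator (Set.Ioc a b) h t :=
        fun t => by by_cases ht : t ∈ Set.Ioc a b <;> simp [ht]
      simp only [this]
      rw [intervalIntegral.integral_of_le zero_le_one, intervalIntegral.integral_of_le hab,
        setIntegral_indicator measurableSet_Ioc, Set.inter_eq_self_of_subset_right
          (Set.Ioc_subset_Ioc ha.le hb.le)]
    have h3 := (tendsto_integral_deriv_smoothTransition hg hC a).sub
      (tendsto_integral_deriv_smoothTransition hg hC b)
    have h4 : ∀ᶠ n : ℕ in atTop, (∫ t, n * deriv Real.smoothTransition (n * (t - a)) * g t) -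
        (∫ t, n * deriv Real.smoothTransition (n * (t - b)) * g t) =
        - ∫ t in (0 : ℝ)..1, smoothIndicator a b n t * h t := by
      have hev : ∀ᶠ n : ℕ in atTop, b + 1 / (n : ℝ) < 1 := by
        have := (tendsto_const_div_atTop_nhds_zero_nat (1 : ℝ)).const_add b
        rw [add_zero] at this
        exact this.eventually (gt_mem_nhds hb)
      filter_upwards [eventually_gt_atTop 0, hev] with n hn hbn
      have hn' : (0 : ℝ) < n := by exact_mod_cast hn
      have hsub : tsupport (smoothIndicator a b n) ⊆ Set.Ioo 0 1 :=
        (tsupport_smoothIndicator_subset hab hn).trans fun t ht =>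
          ⟨ha.trans_le ht.1, ht.2.trans_lt hbn⟩
      have hcs : HasCompactSupport (smoothIndicator a b n) :=
        isCompact_Icc.of_isClosed_subset (isClosed_tsupport _)
          (tsupport_smoothIndicator_subset hab hn)
      have h5 := H _ (contDiff_smoothIndicator a b n) hcs hsub
      have hdc : Continuous (deriv (smoothIndicator a b n)) :=
        (contDiff_smoothIndicator a b n).continuous_deriv (by simp)
      have hdg : Continuous fun t => deriv (smoothIndicator a b n) t * g t := hdc.mul hg
      rw [intervalIntegral.integral_add (hdg.intervalIntegrable _ _)
        (hh.continuousOn_mul (contDiff_smoothIndicator a b n).continuous.continuousOn)] at h5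
      have hi : ∀ c : ℝ, Integrable fun t : ℝ =>
          n * deriv Real.smoothTransition (n * (t - c)) * g t := fun c => by
        refine Continuous.integrable_of_hasCompactSupport ?_ (HasCompactSupport.mul_right
          (HasCompactSupport.mul_left (f := fun _ : ℝ => (n : ℝ)) ?_))
        · exact (continuous_const.mul (continuous_deriv_smoothTransition.comp
            (by fun_prop))).mul hg
        · exact hasCompactSupport_deriv_smoothTransition.comp_homeomorph
            ((Homeomorph.subRight c).trans (Homeomorph.mulLeft₀ (n : ℝ) hn'.ne'))
      rw [← integral_sub (hi a) (hi b)]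
      have h6 : ∫ t, (n * deriv Real.smoothTransition (n * (t - a)) * g t -
          n * deriv Real.smoothTransition (n * (t - b)) * g t) =
          ∫ t in (0 : ℝ)..1, deriv (smoothIndicator a b n) t * g t := by
        rw [intervalIntegral.integral_of_le zero_le_one,
          setIntegral_eq_integral_of_forall_compl_eq_zero]
        · refine integral_congr_ae (Eventually.of_forall fun t => ?_)
          dsimp only
          rw [deriv_smoothIndicator]
          ring
        · intro t ht
          have : t ∉ tsupport (deriv (smoothIndicator a b n)) := fun h' =>
            ht (Set.Ioo_subset_Ioc_self (hsub (closure_minimal support_deriv_subset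
              (isClosed_tsupport _) h')))
          rw [image_eq_zero_of_notMem_tsupport this, zero_mul]
      rw [h6]
      linarith
    have h7 := tendsto_nhds_unique (h3.congr' h4) h1.neg
    rw [h2] at h7
    linarith
  set P : ℝ → ℝ := fun r => ∫ t in (0 : ℝ)..r, h t with hP
  have hPc : ContinuousOn P (Set.Icc 0 1) := by
    have := intervalIntegral.continuousOn_primitive_interval' hh Set.left_mem_uIcc
    rwa [Set.uIcc_of_le zero_le_one] at this
  have hhalf : (1 / 2 : ℝ) ∈ Set.Icc (0 : ℝ) 1 := by norm_num
  have hsub : ∀ {a b : ℝ}, a ∈ Set.Icc (0 : ℝ) 1 → b ∈ Set.Icc (0 : ℝ) 1 →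
      ∫ t in a..b, h t = P b - P a := fun ha hb =>
    (intervalIntegral.integral_interval_sub_left (hint (by simp) hb) (hint (by simp) ha)).symm
  -- By continuity, constancy of `g - P` on the open interval extends to the endpoints; `1 / 2` is
  -- just an interior base point.
  have hconst : Set.EqOn (fun r => g r - P r) (fun _ => g (1 / 2) - P (1 / 2))
      (Set.Icc 0 1) := by
    refine Set.EqOn.of_subset_closure (s := Set.Ioo 0 1) (fun r hr => ?_)
      (hg.continuousOn.sub hPc) continuousOn_const Set.Ioo_subset_Icc_self
      (closure_Ioo zero_ne_one).ge
    rcases le_total r (1 / 2) with hr2 | hr2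
    · have := key r (1 / 2) hr.1 hr2 (by norm_num)
      rw [hsub (Set.Ioo_subset_Icc_self hr) hhalf] at this
      linarith
    · have := key (1 / 2) r (by norm_num) hr2 hr.2
      rw [hsub hhalf (Set.Ioo_subset_Icc_self hr)] at this
      linarith
  have ha1 : a ∈ Set.Icc (0 : ℝ) 1 := ⟨ha, hab.trans hb⟩
  have hb1 : b ∈ Set.Icc (0 : ℝ) 1 := ⟨ha.trans hab, hb⟩
  have e1 := hconst ha1
  have e2 := hconst hb1
  dsimp only at e1 e2
  rw [hsub ha1 hb1]
  linarith

end DuBoisReymond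

/-! ### The continuity equation on the plans -/

section ContinuityEquation

variable {d : ℕ}

/-- The space-time derivative in the direction `(1, v)` is jointly continuous in point and velocity,
and affine in `v`; measurability, growth bounds and averaging all use this form. -/
lemma transportIntegrand_eq_fderiv {φ : ℝ × Euc d → ℝ} (hφ : ContDiff ℝ ∞ φ)
    (v : I → Euc d → Euc d) (t : I) (x : Euc d) :
    transportIntegrand φ v t x = fderiv ℝ φ (t, x) (1, v t x) := by
  have h : HasFDerivAt φ (fderiv ℝ φ ((t : ℝ), x)) ((t : ℝ), x) :=
    (hφ.differentiable (by simp) _).hasFDerivAt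
  have h1 : HasDerivAt (fun s : ℝ => φ (s, x)) (fderiv ℝ φ ((t : ℝ), x) (1, 0)) t :=
    h.comp_hasDerivAt (f := fun s : ℝ => (s, x)) (t : ℝ)
      ((hasDerivAt_id _).prodMk (hasDerivAt_const _ _))
  have h2 : HasFDerivAt (fun z => φ ((t : ℝ), z))
      ((fderiv ℝ φ ((t : ℝ), x)).comp (ContinuousLinearMap.inr ℝ ℝ (Euc d))) x :=
    h.comp x (hasFDerivAt_prodMk_right _ _)
  rw [transportIntegrand, h1.deriv, gradient, h2.fderiv, InnerProductSpace.toDual_symm_apply,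
    ContinuousLinearMap.comp_apply, ← map_add]
  simp

lemma exists_enorm_fderiv_apply_le {φ : ℝ × Euc d → ℝ} (hφ : IsTestFunction φ) :
    ∃ C : NNReal, ∀ p w, ‖fderiv ℝ φ p (1, w)‖ₑ ≤ C * (1 + ‖w‖ₑ) := by
  obtain ⟨C, hC⟩ := (hφ.1.continuous_fderiv (by simp)).bounded_above_of_compact_support
    (hφ.2.1.fderiv ℝ)
  refine ⟨C.toNNReal, fun p w => ?_⟩
  have h1 : ‖fderiv ℝ φ p (1, w)‖ ≤ C.toNNReal * (1 + ‖w‖) := by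
    refine (ContinuousLinearMap.le_opNorm _ _).trans (mul_le_mul ((hC p).trans
      (Real.le_coe_toNNReal C)) ?_ (norm_nonneg _) (NNReal.coe_nonneg _))
    rw [Prod.norm_def, norm_one]
    exact max_le (by linarith [norm_nonneg w]) (by linarith)
  have h2 : ‖fderiv ℝ φ p (1, w)‖₊ ≤ C.toNNReal * (1 + ‖w‖₊) := by
    exact_mod_cast h1
  simp only [enorm_eq_nnnorm]
  exact_mod_cast h2

lemma measurable_fderiv_apply {φ : ℝ × Euc d → ℝ} (hφ : ContDiff ℝ ∞ φ) {X : Type*}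
    [MeasurableSpace X] {p : X → ℝ × Euc d} {w : X → Euc d} (hp : Measurable p)
    (hw : Measurable w) : Measurable fun x => fderiv ℝ φ (p x) (1, w x) := by
  have h1 : Continuous fun q : (ℝ × Euc d) × Euc d => fderiv ℝ φ q.1 (1, q.2) :=
    ((hφ.continuous_fderiv (by simp)).comp continuous_fst).clm_apply
      (continuous_const.prodMk continuous_snd)
  exact h1.measurable.comp (hp.prodMk hw)

variable {K : I → Kernel (Euc d) (Euc d)} [∀ t, IsMarkovKernel (K t)] {μ₁ : Measure (Euc d)}
  [IsProbabilityMeasure μ₁] {κ : Kernel (I × Euc d) (Euc d)} [IsMarkovKernel κ]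

/-- The plans `κ(t, y, ·) ×_y μ₁` as a kernel in the time variable. -/
noncomputable def planKernel (κ : Kernel (I × Euc d) (Euc d)) (μ₁ : Measure (Euc d)) :
    Kernel I (Euc d × Euc d) :=
  ((Kernel.const I μ₁) ⊗ₖ κ).map Prod.swap

instance : IsMarkovKernel (planKernel κ μ₁) := Kernel.IsMarkovKernel.map _ measurable_swap

lemma planKernel_apply (hκ : ∀ᵐ y ∂μ₁, ∀ t, κ (t, y) = K t y) (t : I) :
    planKernel κ μ₁ t = plan (K t) μ₁ := by
  rw [planKernel, Kernel.map_apply _ measurable_swap, plan]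
  congr 1
  ext s hs
  rw [Kernel.compProd_apply hs, Measure.compProd_apply hs, Kernel.const_apply]
  refine lintegral_congr_ae ?_
  filter_upwards [hκ] with y hy
  rw [hy t]

lemma measurable_lintegral_plan (hκ : ∀ᵐ y ∂μ₁, ∀ t, κ (t, y) = K t y)
    {f : I × Euc d × Euc d → ℝ≥0∞} (hf : Measurable f) :
    Measurable fun t => ∫⁻ p, f (t, p) ∂(plan (K t) μ₁) := by
  simp only [← planKernel_apply hκ]
  exact hf.lintegral_kernel_prod_right'

/-- Exchanging the order of integration in `t` and `y`. -/
lemma integral_integral_plan_swap (hκ : ∀ᵐ y ∂μ₁, ∀ t, κ (t, y) = K t y)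
    {F : I × Euc d × Euc d → ℝ} (hF : Measurable F)
    (hfin : ∫⁻ t, ∫⁻ p, ‖F (t, p)‖ₑ ∂(plan (K t) μ₁) < ⊤) :
    Integrable (fun t => ∫ p, F (t, p) ∂(plan (K t) μ₁)) ∧
    ∫ t, ∫ p, F (t, p) ∂(plan (K t) μ₁) =
      ∫ y, (∫ t : I, ∫ x, F (t, x, y) ∂(K t y)) ∂μ₁ := by
  let F' : (I × Euc d) × Euc d → ℝ := fun q => F (q.1.1, q.2, q.1.2)
  have hF' : Measurable F' := hF.comp (by fun_prop)
  have hFi : Integrable F' (((volume : Measure I).prod μ₁) ⊗ₘ κ) := by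
    refine ⟨hF'.aestronglyMeasurable, ?_⟩
    rw [HasFiniteIntegral, Measure.lintegral_compProd hF'.enorm,
      lintegral_prod _ (hF'.enorm.lintegral_kernel_prod_right').aemeasurable]
    refine lt_of_le_of_lt (le_of_eq (lintegral_congr fun t => ?_)) hfin
    have hm : Measurable fun p => ‖F (t, p)‖ₑ := (hF.comp measurable_prodMk_left).enorm
    rw [lintegral_plan (K t) μ₁ hm]
    refine lintegral_congr_ae ?_
    filter_upwards [hκ] with y hy
    rw [hy t]
  have hG : Integrable (fun q : I × Euc d => ∫ x, F' (q, x) ∂(κ q))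
      ((volume : Measure I).prod μ₁) := hFi.integral_compProd
  -- Only almost every `t` has `F (t, ·)` integrable for the plan, which is needed to iterate the
  -- inner integral.
  have hae : ∀ᵐ t : I, ∫ p, F (t, p) ∂(plan (K t) μ₁) =
      ∫ y, ∫ x, F' ((t, y), x) ∂(κ (t, y)) ∂μ₁ := by
    filter_upwards [ae_lt_top (measurable_lintegral_plan hκ hF.enorm) hfin.ne] with t ht
    have hm : Measurable fun p => F (t, p) := hF.comp measurable_prodMk_left
    rw [integral_plan (K t) μ₁ hm.stronglyMeasurable ⟨hm.aestronglyMeasurable, ht⟩]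
    refine integral_congr_ae ?_
    filter_upwards [hκ] with y hy
    rw [hy t]
  refine ⟨hG.integral_prod_left.congr (hae.mono fun t ht => ht.symm), ?_⟩
  rw [integral_congr_ae hae, integral_integral_swap hG]
  refine integral_congr_ae ?_
  filter_upwards [hκ] with y hy
  simp only [hy, F']

/-- The `L²(α_t)` norm of the velocity field. -/
noncomputable def planSpeed (K : I → Kernel (Euc d) (Euc d)) (μ₁ : Measure (Euc d))
    (v : I → Euc d → Euc d → Euc d) (t : I) : ℝ≥0∞ :=
  eLpNorm (fun p : Euc d × Euc d => v t p.2 p.1) 2 (plan (K t) μ₁)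

variable {v : I → Euc d → Euc d → Euc d}

lemma measurable_planSpeed (hκ : ∀ᵐ y ∂μ₁, ∀ t, κ (t, y) = K t y)
    (hv : Measurable fun p : I × Euc d × Euc d => v p.1 p.2.2 p.2.1) :
    Measurable (planSpeed K μ₁ v) := by
  have h : ∀ t, planSpeed K μ₁ v t =
      (∫⁻ p, ‖v t p.2 p.1‖ₑ ^ (2 : ℝ) ∂(plan (K t) μ₁)) ^ (1 / (2 : ℝ)) := fun t => by
    rw [planSpeed, eLpNorm_eq_lintegral_rpow_enorm_toReal two_ne_zero ENNReal.ofNat_ne_top]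
    simp
  rw [funext h]
  exact (measurable_lintegral_plan hκ (f := fun q : I × Euc d × Euc d =>
    ‖v q.1 q.2.2 q.2.1‖ₑ ^ (2 : ℝ)) (hv.enorm.pow_const _)).pow_const _

lemma measurable_velocity (hv : Measurable fun p : I × Euc d × Euc d => v p.1 p.2.2 p.2.1)
    (t : I) : Measurable fun p : Euc d × Euc d => v t p.2 p.1 :=
  hv.comp (g := fun p : I × Euc d × Euc d => v p.1 p.2.2 p.2.1) (f := fun p => (t, p))
    measurable_prodMk_left

lemma lintegral_enorm_velocity_le
    (hv : Measurable fun p : I × Euc d × Euc d => v p.1 p.2.2 p.2.1) (t : I) :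
    ∫⁻ p, ‖v t p.2 p.1‖ₑ ∂(plan (K t) μ₁) ≤ planSpeed K μ₁ v t := by
  rw [← eLpNorm_one_eq_lintegral_enorm (f := fun p : Euc d × Euc d => v t p.2 p.1)]
  exact eLpNorm_le_eLpNorm_of_exponent_le one_le_two
    (measurable_velocity hv t).aestronglyMeasurable

lemma lintegral_plan_fderiv_lt_top
    (hv : Measurable fun p : I × Euc d × Euc d => v p.1 p.2.2 p.2.1)
    (hL1 : ∫⁻ t : I, planSpeed K μ₁ v t < ⊤) {φ : ℝ × Euc d → ℝ} (hφ : IsTestFunction φ) :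
    ∫⁻ t : I, ∫⁻ p, ‖fderiv ℝ φ ((t : ℝ), p.1) (1, v t p.2 p.1)‖ₑ ∂(plan (K t) μ₁) < ⊤ := by
  obtain ⟨C, hC⟩ := exists_enorm_fderiv_apply_le hφ
  calc _ ≤ ∫⁻ t : I, C * (1 + planSpeed K μ₁ v t) := by
        refine lintegral_mono fun t => ?_
        refine (lintegral_mono fun p => hC _ _).trans ?_
        rw [lintegral_const_mul' _ _ ENNReal.coe_ne_top, lintegral_add_left measurable_const]
        gcongr
        · simp
        · exact lintegral_enorm_velocity_le hv t
    _ = C * (1 + ∫⁻ t : I, planSpeed K μ₁ v t) := by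
        rw [lintegral_const_mul' _ _ ENNReal.coe_ne_top, lintegral_add_left measurable_const]
        simp
    _ < ⊤ := ENNReal.mul_lt_top ENNReal.coe_lt_top
        (ENNReal.add_lt_top.2 ⟨ENNReal.one_lt_top, hL1⟩)

/-- The continuity equation on the level of the plans. -/
lemma plan_continuityEquation (hκ : ∀ᵐ y ∂μ₁, ∀ t, κ (t, y) = K t y)
    (hv : Measurable fun p : I × Euc d × Euc d => v p.1 p.2.2 p.2.1)
    (hCE : ∀ᵐ y ∂μ₁, SolvesCE (fun t => K t y) (fun t => v t y))
    (hL1 : ∫⁻ t : I, planSpeed K μ₁ v t < ⊤) {φ : ℝ × Euc d → ℝ} (hφ : IsTestFunction φ) :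
    Integrable (fun t : I => ∫ p, fderiv ℝ φ ((t : ℝ), p.1) (1, v t p.2 p.1)
      ∂(plan (K t) μ₁)) ∧
    ∫ t : I, ∫ p, fderiv ℝ φ ((t : ℝ), p.1) (1, v t p.2 p.1) ∂(plan (K t) μ₁) = 0 := by
  have h := integral_integral_plan_swap (F := fun q : I × Euc d × Euc d =>
    fderiv ℝ φ ((q.1 : ℝ), q.2.1) (1, v q.1 q.2.2 q.2.1)) hκ
    (measurable_fderiv_apply hφ.1 (by fun_prop) hv) (lintegral_plan_fderiv_lt_top hv hL1 hφ)
  refine ⟨h.1, h.2.trans (integral_eq_zero_of_ae ?_)⟩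
  filter_upwards [hCE] with y hy
  have := (hy φ hφ).2
  simpa only [transportIntegrand_eq_fderiv hφ.1, Pi.zero_apply] using this

end ContinuityEquation

/-! ### Passing between the unit interval and the line -/

section UnitInterval

/-- The extension of a function on the unit interval to the line by its boundary values. -/
noncomputable def extendI {α : Type*} (f : I → α) (r : ℝ) : α := f (Set.projIcc 0 1 zero_le_one r)

@[simp] lemma extendI_coe {α : Type*} (f : I → α) (t : I) : extendI f t = f t := by
  rw [extendI, Set.projIcc_val]

lemma integrableOn_extendI {f : I → ℝ} (hf : Integrable f) :
    IntegrableOn (extendI f) (Set.Icc 0 1) := by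
  rw [integrableOn_iff_comap_subtypeVal measurableSet_Icc]
  exact hf.congr (Filter.Eventually.of_forall fun t => (extendI_coe f t).symm)

lemma intervalIntegrable_extendI {f : I → ℝ} (hf : Integrable f) :
    IntervalIntegrable (extendI f) volume 0 1 :=
  IntegrableOn.intervalIntegrable (by
    rw [Set.uIcc_of_le zero_le_one]; exact integrableOn_extendI hf)

lemma intervalIntegral_eq_integral_I {F : ℝ → ℝ} {f : I → ℝ} (h : ∀ t : I, F t = f t) :
    ∫ r in (0 : ℝ)..1, F r = ∫ t, f t := by
  rw [intervalIntegral.integral_of_le zero_le_one, ← integral_Icc_eq_integral_Ioc,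
    ← integral_subtype measurableSet_Icc]
  exact integral_congr_ae (Filter.Eventually.of_forall h)

lemma ae_extendI {p : I → Prop} (hp : ∀ᵐ t, p t) :
    ∀ᵐ r ∂(volume.restrict (Set.Icc (0 : ℝ) 1)), extendI p r := by
  have h := unitInterval.measurePreserving_coe.map_eq
  rw [show (Set.Icc (0 : ℝ) 1) = I from rfl, ← h, unitInterval.measurableEmbedding_coe.ae_map_iff]
  simpa using hp

end UnitInterval

lemma abs_integral_apply_le {X F : Type*} [MeasurableSpace X] [NormedAddCommGroup F]
    [NormedSpace ℝ F] {P : Measure X} {D : X → F →L[ℝ] ℝ} {V : X → F} (hD : MemLp D 2 P)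
    (hV : MemLp V 2 P) :
    |∫ x, D x (V x) ∂P| ≤ (eLpNorm V 2 P).toReal * √(∫ x, ‖D x‖ ^ 2 ∂P) := by
  have h1 : |∫ x, D x (V x) ∂P| ≤ ∫ x, ‖(‖D x‖)‖ * ‖(‖V x‖)‖ ∂P := by
    rw [← Real.norm_eq_abs]
    refine (norm_integral_le_integral_norm _).trans ?_
    refine integral_mono_of_nonneg (Filter.Eventually.of_forall fun _ => norm_nonneg _) ?_
      (Filter.Eventually.of_forall fun x => ?_)
    · exact MemLp.integrable_mul hD.norm.norm hV.norm.norm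
    · simpa using (D x).le_opNorm (V x)
  refine h1.trans ((integral_mul_norm_le_Lp_mul_Lq Real.HolderConjugate.two_two
    (by simpa using hD.norm) (by simpa using hV.norm)).trans (le_of_eq ?_))
  rw [hV.eLpNorm_eq_integral_rpow_norm two_ne_zero ENNReal.ofNat_ne_top,
    ENNReal.toReal_ofReal (by positivity), Real.sqrt_eq_rpow, mul_comm]
  simp

/-! ### The weak speed of the first marginal -/

section WeakSpeed

variable {d : ℕ}

lemma exists_boundedContinuousFunction_eq {f : Euc d → ℝ} (hf : Continuous f)
    (hc : HasCompactSupport f) : ∃ g : BoundedContinuousFunction (Euc d) ℝ, ⇑g = f := by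
  obtain ⟨C, hC⟩ := hf.bounded_above_of_compact_support hc
  exact ⟨BoundedContinuousFunction.ofNormedAddCommGroup f hf C hC, rfl⟩

lemma isTestFunction_mul {χ : ℝ → ℝ} {η : Euc d → ℝ} (hχ : ContDiff ℝ ∞ χ)
    (hχc : HasCompactSupport χ) (hχs : tsupport χ ⊆ Set.Ioo 0 1) (hη : ContDiff ℝ ∞ η)
    (hηc : HasCompactSupport η) : IsTestFunction fun p : ℝ × Euc d => χ p.1 * η p.2 := by
  have hsub : Function.support (fun p : ℝ × Euc d => χ p.1 * η p.2) ⊆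
      tsupport χ ×ˢ tsupport η := fun p hp =>
    ⟨subset_closure (left_ne_zero_of_mul hp), subset_closure (right_ne_zero_of_mul hp)⟩
  refine ⟨(hχ.comp contDiff_fst).mul (hη.comp contDiff_snd),
    HasCompactSupport.of_support_subset_isCompact (hχc.isCompact.prod hηc.isCompact) hsub, ?_⟩
  exact (closure_minimal hsub ((isClosed_tsupport _).prod (isClosed_tsupport _))).trans
    (Set.prod_mono hχs (Set.subset_univ _))

lemma fderiv_mul_apply {χ : ℝ → ℝ} {η : Euc d → ℝ} (hχ : ContDiff ℝ ∞ χ)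
    (hη : ContDiff ℝ ∞ η) (t : ℝ) (x w : Euc d) :
    fderiv ℝ (fun p : ℝ × Euc d => χ p.1 * η p.2) (t, x) (1, w) =
      deriv χ t * η x + χ t * fderiv ℝ η x w := by
  have h1 : HasFDerivAt (fun p : ℝ × Euc d => χ p.1)
      ((fderiv ℝ χ t).comp (ContinuousLinearMap.fst ℝ ℝ (Euc d))) (t, x) :=
    HasFDerivAt.comp (t, x) (hχ.differentiable (by simp) t).hasFDerivAt hasFDerivAt_fst
  have h2 : HasFDerivAt (fun p : ℝ × Euc d => η p.2)
      ((fderiv ℝ η x).comp (ContinuousLinearMap.snd ℝ ℝ (Euc d))) (t, x) :=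
    HasFDerivAt.comp (t, x) (hη.differentiable (by simp) x).hasFDerivAt hasFDerivAt_snd
  have h3 : HasFDerivAt (fun p : ℝ × Euc d => χ p.1 * η p.2) _ (t, x) := h1.mul h2
  rw [h3.fderiv]
  simp
  ring

variable {K : I → Kernel (Euc d) (Euc d)} [∀ t, IsMarkovKernel (K t)] {μ₁ : Measure (Euc d)}
  [IsProbabilityMeasure μ₁] {κ : Kernel (I × Euc d) (Euc d)} [IsMarkovKernel κ]
  {v : I → Euc d → Euc d → Euc d}

lemma memLp_velocity (hv : Measurable fun p : I × Euc d × Euc d => v p.1 p.2.2 p.2.1) {t : I}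
    (ht : planSpeed K μ₁ v t < ⊤) :
    MemLp (fun p : Euc d × Euc d => v t p.2 p.1) 2 (plan (K t) μ₁) :=
  ⟨(measurable_velocity hv t).aestronglyMeasurable, ht⟩

/-- Cauchy–Schwarz is applied on the plans, so no disintegration is needed here: `Dη` depends on `x`
alone, and its `L²(α_r)` norm is already an `L²(ν_r)` norm. -/
lemma hasWeakSpeed_firstMarginal (hκ : ∀ᵐ y ∂μ₁, ∀ t, κ (t, y) = K t y)
    (hv : Measurable fun p : I × Euc d × Euc d => v p.1 p.2.2 p.2.1)
    (hCE : ∀ᵐ y ∂μ₁, SolvesCE (fun t => K t y) (fun t => v t y))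
    (hL1 : ∫⁻ t : I, planSpeed K μ₁ v t < ⊤)
    (hN : NarrowlyContinuous fun t => firstMarginal (K t) μ₁) :
    HasWeakSpeed (extendI fun t => firstMarginal (K t) μ₁)
      (extendI fun t => (planSpeed K μ₁ v t).toReal) 0 1 := by
  intro η hη hηc a b ha hab hb
  have hfin : ∀ᵐ t : I, planSpeed K μ₁ v t < ⊤ :=
    ae_lt_top (measurable_planSpeed hκ hv) hL1.ne
  obtain ⟨G, hG⟩ := exists_boundedContinuousFunction_eq hη.continuous hηc
  obtain ⟨Q, hQ⟩ := exists_boundedContinuousFunction_eq (contDiff_sqNormFDeriv hη).continuous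
    (hasCompactSupport_sqNormFDeriv (c := 0) (by simpa using hηc))
  obtain ⟨L, hL⟩ := (hη.continuous_fderiv (by simp)).bounded_above_of_compact_support
    (hηc.fderiv ℝ)
  have hDm : Measurable fun p : Euc d × Euc d => fderiv ℝ η p.1 :=
    ((hη.continuous_fderiv (by simp)).comp continuous_fst).measurable
  have hDc : Continuous fun q : Euc d × Euc d => fderiv ℝ η q.1 q.2 :=
    ((hη.continuous_fderiv (by simp)).comp continuous_fst).clm_apply continuous_snd
  have hpush : ∀ (f : Euc d → ℝ), Continuous f → ∀ t : I,
      ∫ x, f x ∂(firstMarginal (K t) μ₁) = ∫ p, f p.1 ∂(plan (K t) μ₁) := fun f hf t =>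
    integral_map measurable_fst.aemeasurable hf.aestronglyMeasurable
  set g : I → ℝ := fun t => ∫ x, η x ∂(firstMarginal (K t) μ₁) with hg
  set h : I → ℝ := fun t => ∫ p, fderiv ℝ η p.1 (v t p.2 p.1) ∂(plan (K t) μ₁) with hh
  have hgc : Continuous g := by
    have := hN G
    rwa [hG] at this
  have hgb : ∀ t, |g t| ≤ ‖G‖ := fun t => by
    have := norm_integral_le_of_norm_le_const (μ := firstMarginal (K t) μ₁) (f := η) (C := ‖G‖)
      (Filter.Eventually.of_forall fun x => hG ▸ G.norm_coe_le_norm x)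
    simpa using this
  have hhi : Integrable h := by
    have hFm : Measurable fun q : I × Euc d × Euc d =>
        fderiv ℝ η q.2.1 (v q.1 q.2.2 q.2.1) := by
      exact hDc.measurable.comp ((by fun_prop : Measurable fun q : I × Euc d × Euc d =>
        q.2.1).prodMk hv)
    refine (integral_integral_plan_swap (μ₁ := μ₁) (K := K) hκ hFm ?_).1
    calc _ ≤ ∫⁻ t : I, L.toNNReal * planSpeed K μ₁ v t := by
          refine lintegral_mono fun t => ?_
          refine le_trans (lintegral_mono fun p => ?_)
            ((lintegral_const_mul' L.toNNReal _ ENNReal.coe_ne_top).trans_le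
              (mul_le_mul_right (lintegral_enorm_velocity_le hv t) _))
          refine (ContinuousLinearMap.le_opENorm _ _).trans ?_
          gcongr
          rw [enorm_eq_nnnorm, ENNReal.coe_le_coe, ← NNReal.coe_le_coe]
          exact (hL p.1).trans (Real.le_coe_toNNReal L)
      _ < ⊤ := by
          rw [lintegral_const_mul' _ _ ENNReal.coe_ne_top]
          exact ENNReal.mul_lt_top ENNReal.coe_lt_top hL1
  have hvi : ∀ {t : I}, planSpeed K μ₁ v t < ⊤ →
      Integrable (fun p : Euc d × Euc d => fderiv ℝ η p.1 (v t p.2 p.1)) (plan (K t) μ₁) := by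
    intro t ht
    refine (((memLp_velocity hv ht).integrable one_le_two).norm.const_mul L).mono' ?_ ?_
    · exact (hDc.measurable.comp
        (measurable_fst.prodMk (measurable_velocity hv t))).aestronglyMeasurable
    · exact Filter.Eventually.of_forall fun p =>
        ((fderiv ℝ η p.1).le_opNorm _).trans (by gcongr; exact hL _)
  have key := sub_eq_integral_of_forall_integral_eq_zero (g := extendI g) (h := extendI h)
    (hgc.comp continuous_projIcc) (fun r => hgb _) (intervalIntegrable_extendI hhi)
    (fun χ hχ hχc hχs => by
      have h1 := (plan_continuityEquation hκ hv hCE hL1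
        (isTestFunction_mul hχ hχc hχs hη hηc)).2
      refine Eq.trans ?_ h1
      refine (intervalIntegral_eq_integral_I (f := fun t : I => deriv χ t * g t + χ t * h t)
        fun t => by simp).trans (integral_congr_ae ?_)
      filter_upwards [hfin] with t ht
      simp only [fderiv_mul_apply hχ hη]
      have hηi : Integrable (fun p : Euc d × Euc d => η p.1) (plan (K t) μ₁) := by
        rw [← hG]
        exact ((G.compContinuous ⟨Prod.fst, continuous_fst⟩).integrable _)
      rw [integral_add (hηi.const_mul _) ((hvi ht).const_mul _), integral_const_mul,
        integral_const_mul, ← hpush η hη.continuous])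
    ha hab hb
  have hgν : ∀ r, extendI g r = ∫ x, η x ∂(extendI (fun t => firstMarginal (K t) μ₁) r) :=
    fun r => rfl
  rw [← hgν, ← hgν, key]
  have hsub : Set.uIcc a b ⊆ Set.uIcc 0 1 := by
    rw [Set.uIcc_of_le hab, Set.uIcc_of_le zero_le_one]
    exact Set.Icc_subset_Icc ha hb
  have hmi : Integrable fun t : I => (planSpeed K μ₁ v t).toReal :=
    integrable_toReal_of_lintegral_ne_top (measurable_planSpeed hκ hv).aemeasurable hL1.ne
  -- Narrow continuity makes this factor continuous, so its product with the integrable speed is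
  -- integrable.
  have hQc : Continuous fun r : ℝ => √(∫ x, ‖fderiv ℝ η x‖ ^ 2
      ∂(extendI (fun t => firstMarginal (K t) μ₁) r)) := by
    have h1 := hN Q
    rw [hQ] at h1
    exact Real.continuous_sqrt.comp (h1.comp continuous_projIcc)
  refine intervalIntegral.integral_mono_ae_restrict hab
    ((intervalIntegrable_extendI hhi).mono_set hsub)
    (((intervalIntegrable_extendI hmi).mono_set hsub).mul_continuousOn hQc.continuousOn) ?_
  refine ae_restrict_of_ae_restrict_of_subset (Set.Icc_subset_Icc ha hb) ?_
  filter_upwards [ae_extendI hfin] with r hr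
  have hDL : MemLp (fun p : Euc d × Euc d => fderiv ℝ η p.1) 2
      (plan (K (Set.projIcc 0 1 zero_le_one r)) μ₁) :=
    MemLp.of_bound hDm.aestronglyMeasurable L (Filter.Eventually.of_forall fun p => hL _)
  have h1 := abs_integral_apply_le hDL (memLp_velocity hv hr)
  refine (le_abs_self _).trans (h1.trans (le_of_eq ?_))
  have h2 := hpush (sqNormFDeriv η) (contDiff_sqNormFDeriv hη).continuous
    (Set.projIcc 0 1 zero_le_one r)
  simp only [sqNormFDeriv] at h2
  rw [← h2]
  rfl

end WeakSpeed

/-! ### Second moments along the curve -/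

section Moments

variable {d : ℕ}

lemma W2_comm_le (μ ν : Measure (Euc d)) : W2 μ ν ≤ W2 ν μ := by
  refine le_iInf₂ fun γ hγ => iInf₂_le_of_le (γ.map Prod.swap) ⟨?_, ?_⟩ ?_
  · rw [Measure.map_map measurable_fst measurable_swap]
    exact hγ.2
  · rw [Measure.map_map measurable_snd measurable_swap]
    exact hγ.1
  · rw [eLpNorm_map_measure (by fun_prop) measurable_swap.aemeasurable, ← eLpNorm_neg]
    refine le_of_eq (congrArg (fun f => eLpNorm f 2 γ) (funext fun p => ?_))
    simp

lemma lintegral_enorm_sq_lt_top_iff {μ : Measure (Euc d)} :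
    ∫⁻ x, ‖x‖ₑ ^ 2 ∂μ < ⊤ ↔ eLpNorm (fun x : Euc d => x) 2 μ < ⊤ := by
  rw [eLpNorm_lt_top_iff_lintegral_rpow_enorm_lt_top two_ne_zero ENNReal.ofNat_ne_top]
  simp

/-- Some coupling has finite cost; Minkowski's inequality for `y = x - (x - y)` bounds the second
moment of `ν`. -/
lemma MemP2.of_W2_lt_top {μ ν : Measure (Euc d)} [IsProbabilityMeasure ν] (hμ : MemP2 μ)
    (h : W2 μ ν < ⊤) : MemP2 ν := by
  refine ⟨inferInstance, lintegral_enorm_sq_lt_top_iff.2 ?_⟩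
  have h2 := lintegral_enorm_sq_lt_top_iff.1 hμ.2
  simp only [W2, iInf_lt_iff] at h
  obtain ⟨γ, hγ, hlt⟩ := h
  rw [← hγ.1, eLpNorm_map_measure (by fun_prop) measurable_fst.aemeasurable] at h2
  rw [← hγ.2, eLpNorm_map_measure (by fun_prop) measurable_snd.aemeasurable]
  refine lt_of_le_of_lt ?_ (ENNReal.add_lt_top.2 ⟨h2, hlt⟩)
  refine le_trans (le_of_eq ?_) (eLpNorm_sub_le (by fun_prop) (by fun_prop) one_le_two)
  refine congrArg (fun f => eLpNorm f 2 γ) (funext fun p => ?_)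
  simp

lemma HasL1Speed.isACCurve {μ : I → Measure (Euc d)} (hμ : ∀ t, IsProbabilityMeasure (μ t))
    (h : HasL1Speed μ) {t₀ : I} (h₀ : MemP2 (μ t₀)) : IsACCurve μ := by
  refine ⟨fun t => ?_, h⟩
  obtain ⟨m, -, hm⟩ := h
  refine h₀.of_W2_lt_top ?_
  rcases le_total t₀ t with ht | ht
  · exact (hm _ _ ht).trans_lt ENNReal.ofReal_lt_top
  · exact (W2_comm_le _ _).trans_lt ((hm _ _ ht).trans_lt ENNReal.ofReal_lt_top)

end Moments

/-! ### The averaged velocity -/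

section AveragedVelocity

variable {d : ℕ} {K : I → Kernel (Euc d) (Euc d)} [∀ t, IsMarkovKernel (K t)]
  {μ₁ : Measure (Euc d)} [IsProbabilityMeasure μ₁] {κ : Kernel (I × Euc d) (Euc d)}
  [IsMarkovKernel κ] {v : I → Euc d → Euc d → Euc d} {D : I → Kernel (Euc d) (Euc d)}

lemma hasL1Speed_firstMarginal (hκ : ∀ᵐ y ∂μ₁, ∀ t, κ (t, y) = K t y)
    (hv : Measurable fun p : I × Euc d × Euc d => v p.1 p.2.2 p.2.1)
    (hCE : ∀ᵐ y ∂μ₁, SolvesCE (fun t => K t y) (fun t => v t y))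
    (hL1 : ∫⁻ t : I, planSpeed K μ₁ v t < ⊤)
    (hN : NarrowlyContinuous fun t => firstMarginal (K t) μ₁) :
    HasL1Speed fun t => firstMarginal (K t) μ₁ := by
  have hmi : Integrable fun t : I => (planSpeed K μ₁ v t).toReal :=
    integrable_toReal_of_lintegral_ne_top (measurable_planSpeed hκ hv).aemeasurable hL1.ne
  have hprob : ∀ r, IsProbabilityMeasure (extendI (fun t => firstMarginal (K t) μ₁) r) :=
    fun r => inferInstanceAs (IsProbabilityMeasure (firstMarginal _ μ₁))
  have H := hasWeakSpeed_firstMarginal hκ hv hCE hL1 hN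
  refine ⟨fun r => extendI (fun t => (planSpeed K μ₁ v t).toReal) r + 1,
    (integrableOn_extendI hmi).add (integrableOn_const (by simp)), fun s t hst => ?_⟩
  have hsub : Set.uIcc (s : ℝ) t ⊆ Set.uIcc 0 1 := by
    rw [Set.uIcc_of_le zero_le_one]
    exact Set.uIcc_subset_Icc s.2 t.2
  have H' : HasWeakSpeed (extendI fun t => firstMarginal (K t) μ₁)
      (extendI fun t => (planSpeed K μ₁ v t).toReal) s t :=
    fun η hη hηc a b ha hab hb => H η hη hηc a b (s.2.1.trans ha) hab (hb.trans t.2.2)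
  have h := H'.W2_le (fun r => ENNReal.toReal_nonneg)
    ((intervalIntegrable_extendI hmi).mono_set hsub) hst
  rwa [extendI_coe, extendI_coe] at h

lemma ae_integrable_disintegration
    (hv : Measurable fun p : I × Euc d × Euc d => v p.1 p.2.2 p.2.1)
    (hD : ∀ t, IsDisintegration (plan (K t) μ₁) (D t)) {t : I} (ht : planSpeed K μ₁ v t < ⊤) :
    ∀ᵐ x ∂(firstMarginal (K t) μ₁), Integrable (fun y => v t y x) (D t x) := by
  have := (hD t).1
  have h1 := (memLp_velocity hv ht).integrable one_le_two
  rw [← (hD t).2] at h1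
  exact ((Measure.integrable_compProd_iff h1.aestronglyMeasurable).1 h1).1

/-- A jointly measurable version of the averaged velocity. -/
lemma exists_measurable_averagedVelocity (hκ : ∀ᵐ y ∂μ₁, ∀ t, κ (t, y) = K t y)
    (hv : Measurable fun p : I × Euc d × Euc d => v p.1 p.2.2 p.2.1)
    (hD : ∀ t, IsDisintegration (plan (K t) μ₁) (D t)) :
    ∃ w : I → Euc d → Euc d, Measurable (fun p : I × Euc d => w p.1 p.2) ∧
      ∀ t, w t =ᵐ[firstMarginal (K t) μ₁] averagedVelocity v D t := by
  -- The disintegrations `D t` are chosen separately for each `t`. The conditional kernel of the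
  -- whole family is measurable in `(t, x)`, and for each fixed `t` a.e. uniqueness of
  -- disintegrations identifies it with `D t`.
  set η := (planKernel κ μ₁).condKernel with hη
  refine ⟨fun t x => ∫ y, v t y x ∂(η (t, x)), ?_, fun t => ?_⟩
  · have h1 : Measurable fun q : (I × Euc d) × Euc d => v q.1.1 q.2 q.1.2 :=
      hv.comp (by fun_prop : Measurable fun q : (I × Euc d) × Euc d => (q.1.1, q.1.2, q.2))
    exact (h1.stronglyMeasurable.integral_kernel_prod_right' (κ := η)).measurable
  · have hDt := (hD t).1
    have h1 := eq_condKernel_of_measure_eq_compProd (D t) (hD t).2.symm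
    let ηt : Kernel (Euc d) (Euc d) := η.comap (Prod.mk t) measurable_prodMk_left
    have h2 : plan (K t) μ₁ = (plan (K t) μ₁).fst ⊗ₘ ηt := by
      have h3 : ((planKernel κ μ₁).fst ⊗ₖ η) t = planKernel κ μ₁ t := by
        rw [Kernel.disintegrate]
      rw [planKernel_apply hκ] at h3
      conv_lhs => rw [← h3]
      ext s hs
      rw [Kernel.compProd_apply hs, Measure.compProd_apply hs, Kernel.fst_apply,
        planKernel_apply hκ]
      rfl
    have h4 := eq_condKernel_of_measure_eq_compProd ηt h2
    filter_upwards [h1, h4] with x hx1 hx2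
    rw [averagedVelocity, hx1, ← hx2]
    rfl

lemma enorm_averagedVelocity_le (t : I) (x : Euc d) :
    ‖averagedVelocity v D t x‖ₑ ≤ ∫⁻ y, ‖v t y x‖ₑ ∂(D t x) :=
  enorm_integral_le_lintegral_enorm _

/-- The averaged velocity solves the continuity equation. -/
lemma solvesCE_averagedVelocity (hκ : ∀ᵐ y ∂μ₁, ∀ t, κ (t, y) = K t y)
    (hv : Measurable fun p : I × Euc d × Euc d => v p.1 p.2.2 p.2.1)
    (hCE : ∀ᵐ y ∂μ₁, SolvesCE (fun t => K t y) (fun t => v t y))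
    (hL1 : ∫⁻ t : I, planSpeed K μ₁ v t < ⊤)
    (hD : ∀ t, IsDisintegration (plan (K t) μ₁) (D t)) :
    SolvesCE (fun t => firstMarginal (K t) μ₁) (averagedVelocity v D) := by
  intro φ hφ
  have hDm : ∀ t, IsMarkovKernel (D t) := fun t => (hD t).1
  simp only [transportIntegrand_eq_fderiv hφ.1]
  constructor
  · obtain ⟨C, hC⟩ := exists_enorm_fderiv_apply_le hφ
    calc _ ≤ ∫⁻ t : I, C * (1 + planSpeed K μ₁ v t) := by
          refine lintegral_mono fun t => (lintegral_mono fun x => hC _ _).trans ?_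
          rw [lintegral_const_mul' _ _ ENNReal.coe_ne_top, lintegral_add_left measurable_const]
          gcongr
          · simp
          · refine (lintegral_mono fun x => enorm_averagedVelocity_le t x).trans ?_
            refine le_trans (le_of_eq ?_) (lintegral_enorm_velocity_le hv t)
            conv_rhs => rw [← (hD t).2]
            exact (Measure.lintegral_compProd (measurable_velocity hv t).enorm).symm
      _ = C * (1 + ∫⁻ t : I, planSpeed K μ₁ v t) := by
          rw [lintegral_const_mul' _ _ ENNReal.coe_ne_top, lintegral_add_left measurable_const]
          simp
      _ < ⊤ := ENNReal.mul_lt_top ENNReal.coe_lt_top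
          (ENNReal.add_lt_top.2 ⟨ENNReal.one_lt_top, hL1⟩)
  · rw [← (plan_continuityEquation hκ hv hCE hL1 hφ).2]
    have hΦm : Measurable fun q : I × Euc d × Euc d =>
        fderiv ℝ φ ((q.1 : ℝ), q.2.1) (1, v q.1 q.2.2 q.2.1) :=
      measurable_fderiv_apply hφ.1 (by fun_prop) hv
    refine integral_congr_ae ?_
    filter_upwards [ae_lt_top (measurable_planSpeed hκ hv) hL1.ne,
      ae_lt_top (measurable_lintegral_plan hκ hΦm.enorm)
        (lintegral_plan_fderiv_lt_top hv hL1 hφ).ne] with t ht htΦ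
    have hΦt : Measurable fun p : Euc d × Euc d =>
        fderiv ℝ φ ((t : ℝ), p.1) (1, v t p.2 p.1) := hΦm.comp measurable_prodMk_left
    have hint : Integrable (fun p : Euc d × Euc d =>
        fderiv ℝ φ ((t : ℝ), p.1) (1, v t p.2 p.1)) (plan (K t) μ₁) :=
      ⟨hΦt.aestronglyMeasurable, htΦ⟩
    rw [← (hD t).2] at hint
    conv_rhs => rw [← (hD t).2, Measure.integral_compProd hint]
    refine integral_congr_ae ?_
    filter_upwards [ae_integrable_disintegration hv hD ht] with x hx
    set A := fderiv ℝ φ ((t : ℝ), x)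
    -- The integrand is affine in the velocity and `D t x` is a probability measure, so averaging
    -- over `y` may be moved inside.
    have hsplit : ∀ w, A (1, w) = A (1, 0) +
        (A.comp (ContinuousLinearMap.inr ℝ ℝ (Euc d))) w := fun w => by
      rw [ContinuousLinearMap.comp_apply, ← map_add]
      simp
    change A (1, averagedVelocity v D t x) = ∫ y, A (1, v t y x) ∂(D t x)
    rw [hsplit, integral_congr_ae (Filter.Eventually.of_forall fun y => hsplit (v t y x)),
      integral_add (integrable_const _) (ContinuousLinearMap.integrable_comp _ hx),
      ContinuousLinearMap.integral_comp_comm _ hx]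
    simp [averagedVelocity]

end AveragedVelocity

theorem mainTheorem2 (d : ℕ)
    (K : I → Kernel (Euc d) (Euc d)) (hK : ∀ t, IsMarkovKernel (K t))
    (μ₁ : Measure (Euc d)) (hμ₁ : MemP2 μ₁)
    (v : I → Euc d → Euc d → Euc d)
    (hv : Measurable fun p : I × Euc d × Euc d => v p.1 p.2.2 p.2.1)
    (hAC : ∀ᵐ y ∂μ₁, IsACCurve fun t => K t y)
    (hCE : ∀ᵐ y ∂μ₁, SolvesCE (fun t => K t y) (fun t => v t y))
    (hL1 : ∫⁻ t : I, eLpNorm (fun p : Euc d × Euc d => v t p.2 p.1) 2 (plan (K t) μ₁) < ⊤) :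
    NarrowlyContinuous (fun t => plan (K t) μ₁) ∧
    NarrowlyContinuous (fun t => firstMarginal (K t) μ₁) ∧
    HasL1Speed (fun t => firstMarginal (K t) μ₁) ∧
    ((∃ t₀, MemP2 (firstMarginal (K t₀) μ₁)) → IsACCurve fun t => firstMarginal (K t) μ₁) ∧
    ∀ D : I → Kernel (Euc d) (Euc d), (∀ t, IsDisintegration (plan (K t) μ₁) (D t)) →
      (∀ᵐ t : I, ∀ᵐ x ∂(firstMarginal (K t) μ₁), Integrable (fun y => v t y x) (D t x)) ∧
      (∃ w : I → Euc d → Euc d, Measurable (fun p : I × Euc d => w p.1 p.2) ∧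
        ∀ t, w t =ᵐ[firstMarginal (K t) μ₁] averagedVelocity v D t) ∧
      SolvesCE (fun t => firstMarginal (K t) μ₁) (averagedVelocity v D) := by
  have := hμ₁.1
  -- Absolute continuity of the fibres enters the proof only through their narrow continuity.
  have hnarrow : ∀ᵐ y ∂μ₁, NarrowlyContinuous fun t => K t y := by
    filter_upwards [hAC] with y hy
    exact hy.2.narrowlyContinuous fun t => (hy.1 t).1
  obtain ⟨κ, hκm, hκ⟩ := exists_joint_kernel hnarrow
  have hα := narrowlyContinuous_plan hnarrow
  have hν := narrowlyContinuous_firstMarginal hα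
  have hspeed := hasL1Speed_firstMarginal hκ hv hCE hL1 hν
  refine ⟨hα, hν, hspeed, fun ⟨t₀, ht₀⟩ => hspeed.isACCurve (fun t => inferInstance) ht₀,
    fun D hD => ⟨?_, exists_measurable_averagedVelocity hκ hv hD,
      solvesCE_averagedVelocity hκ hv hCE hL1 hD⟩⟩
  filter_upwards [ae_lt_top (measurable_planSpeed hκ hv) hL1.ne] with t ht
  exact ae_integrable_disintegration hv hD ht
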